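/- Let $n\ge 0$, let the vertices be $1,\dots,n$, and let $n+1$ stand for "no further vertex". A query is a vertex. For every finite sequence $Q=(q(1),\dots,q(T))$ of queries, the sequences of answers $\texttt{Opt-BA}_n(Q)$ and $\texttt{O-t-F-BA}_n(Q)$ of the following two randomized algorithms have the same probability distribution. **$\texttt{Opt-BA}_n$.** First sample the Barabási–Albert graph ($m=1$): start with the self-loop $e_1=(1,1)$; for $j=2,\dots,n$ add the edge $e_j=(j,i)$, where $i$ is drawn with probability $\deg(i)/(2(j-1))$, $\deg$ being the degree (out-degree plus in-degree) in the graph with edges $e_1,\dots,e_{j-1}$. Store the graph and ignore the orientation of the edges. A query on $v$ is answered by the least neighbor of $v$ that is larger than all earlier answers to queries on $v$ (vertex $1$ is a neighbor of itself), and by $n+1$ if there is none. **$\texttt{O-t-F-BA}_n$.** The memory consists of: pointers $u(j)$ with flags in $\{\mathtt{dir},\mathtt{rec}\}$; values $\mathrm{front}(j)$; a heap (multiset of numbers) $\mathrm{heap}_j$ for each $j$. All pointers and fronts are initially undefined ($\mathsf{nil}$), and all heaps are empty. At any time put $\mathrm{child}(j)=\{i\in(j,n]: u(i)=j\}\cup\{n+1\}$,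 $\Phi(j)=\{i<j: \mathrm{front}(i)=\mathsf{nil}\text{ or }\mathrm{front}(i)<j\}$, $\varphi(j)=|\Phi(j)|$, and $K=\{i:\mathrm{front}(i)\ne\mathsf{nil},\ \mathrm{front}(l)\neq i\text{ for all }l\}$; $\mathrm{succ}(A,k)$ is the least element of $A$ larger than $k$. All random choices are independent, and flags are chosen uniformly. * $\mathrm{parent}(j)$: if $u(j)=\mathsf{nil}$, set $u(j)$ to a uniformly random element of $\Phi(j)$ and choose its flag at random; for $j=1$ set instead $u(1)=1$ with flag $\mathtt{dir}$. Return $u(j)$ and its flag. * $\mathrm{toss}(\xi,s+1)$: return $y\in\{0,\dots,s\}$ with probability $P'_{y+1}-P'_y$, where $P'_0=0$, $P'_{s+1}=1$ and $P'_y=1-\frac{\xi-1}{\xi+y-1}$ for $1\le y\le s$. * $\mathrm{next\text{-}child}(j)$: call $\mathrm{parent}(j)$. If $\mathrm{front}(j)\ge n$, return $n+1$. Otherwise let $c=\mathrm{front}(j)$, or $c=j$ if $\mathrm{front}(j)=\mathsf{nil}$; let $a=c+1$, $b=\mathrm{succ}(\mathrm{child}(j),c)$. Repeat: let $s=|[a,b)\setminus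 K|$ and $h=\mathrm{toss}(\varphi(a),s+1)$; if $h=s$, stop with $x=b$; else let $x$ be the element of rank $h$ (counting from $0$) of $[a,b)\setminus K$; if $u(x)=\mathsf{nil}$, set $u(x)=j$ with a random flag and stop with this $x$; else replace $a$ by $x+1$. After stopping set $\mathrm{front}(j)=x$; if $x\le n$ and $\mathrm{front}(x)=\mathsf{nil}$, call $\mathrm{next\text{-}child}(x)$. Return $x$. * $\mathrm{next\text{-}child\text{-}from}(j,k)$: if $k\ge n$, return $n+1$. Let $q=\mathrm{succ}(\mathrm{child}(j),k)$. If $\mathrm{front}(j)\neq\mathsf{nil}$ and $q\le\mathrm{front}(j)$, return $q$; else return $\mathrm{next\text{-}child}(j)$. * $\mathrm{next\text{-}child\text{-}tp}(j,k,\tau)$: put $x=k$ and repeat $x\leftarrow\mathrm{next\text{-}child\text{-}from}(j,x)$ until $x=n+1$ or $x$ has flag $\tau$; return $x$. * $\mathrm{BA\text{-}parent}(j)$: let $(i,f)=\mathrm{parent}(j)$; return $i$ if $f=\mathtt{dir}$, and $\mathrm{BA\text{-}parent}(i)$ otherwise. * A query on $j$ is answered as follows. *First query on $j$*: insert $n+1$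 and $\mathrm{next\text{-}child\text{-}tp}(j,j,\mathtt{dir})$ into $\mathrm{heap}_j$, and for $j=1$ also $\mathrm{next\text{-}child\text{-}tp}(1,1,\mathtt{rec})$; return $\mathrm{BA\text{-}parent}(j)$. *Later queries on $j$*: extract the minimum $r$ of $\mathrm{heap}_j$. If $r=n+1$, insert $n+1$ again and return $n+1$. Otherwise insert $\mathrm{next\text{-}child\text{-}tp}(j,r,\mathtt{dir})$ if $r$ has flag $\mathtt{dir}$, and $\mathrm{next\text{-}child\text{-}tp}(u(r),r,\mathtt{rec})$ if $r$ has flag $\mathtt{rec}$; then insert $\mathrm{next\text{-}child\text{-}tp}(r,r,\mathtt{rec})$, and return $r$. -/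

import Mathlib

/-! Vertices are the natural numbers `1, …, n`; the number `n + 1` stands for "none". -/

namespace BAGen

/-- The least element of `s`, or `n + 1` if `s` is empty. -/
def leastOr (n : ℕ) (s : Finset ℕ) : ℕ :=
  if h : s.Nonempty then s.min' h else n + 1

/-! ### The Barabási–Albert process and the generator that stores the whole graph -/

/-- A graph is given by its list of edges, each written as `(tail, head)`. -/
abbrev Edges := List (ℕ × ℕ)

/-- The degree of `v`, outgoing plus incoming edges (a self-loop contributes two). -/
def deg (v : ℕ) (E : Edges) : ℕ :=
  (E.map Prod.fst).count v + (E.map Prod.snd).count v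

/-- The multiset of all end points of edges; `v` occurs in it `deg v E` times. -/
def endpoints (E : Edges) : Multiset ℕ :=
  ((E.map Prod.fst ++ E.map Prod.snd : List ℕ) : Multiset ℕ)

/-- The normalized degree distribution: `v` has probability `deg v E / (2 |E|)`, see
`degreeDist_apply`. (The value for the graph without edges is never used.) -/
noncomputable def degreeDist (E : Edges) : PMF ℕ :=
  if h : endpoints E ≠ 0 then PMF.ofMultiset (endpoints E) h else PMF.pure 0

theorem degreeDist_apply (E : Edges) (hE : E ≠ []) (v : ℕ) :
    degreeDist E v = (deg v E : ENNReal) / (2 * E.length : ℕ) := by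
  have h : endpoints E ≠ 0 := by
    cases E with
    | nil => exact absurd rfl hE
    | cons e E => simp [endpoints]
  unfold degreeDist
  rw [dif_pos h, PMF.ofMultiset_apply]
  congr 2
  · simp only [endpoints, deg, Multiset.coe_count, List.count_append]
    congr!
  · simp [endpoints, two_mul]

/-- The random process `BA_n`: it starts with the self-loop at vertex `1`; the head of the edge
out of a new vertex is drawn from the normalized degree distribution of the current graph. -/
noncomputable def BA : ℕ → PMF Edges
  | 0 => PMF.pure []
  | 1 => PMF.pure [(1, 1)]
  | j + 2 => (BA (j + 1)).bind fun E => (degreeDist E).map fun i => E ++ [(j + 2, i)]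

/-- The least neighbor of `v` that exceeds `l`, or `n + 1` if there is none. -/
def nextNeighbor (n : ℕ) (E : Edges) (v l : ℕ) : ℕ :=
  leastOr n ((Finset.Icc 1 n).filter fun i => l < i ∧ ((i, v) ∈ E ∨ (v, i) ∈ E))

/-- Answers to a sequence of next-neighbor queries from the stored graph. Here `last v` is
the largest earlier answer to a query on `v`, and `0` if there was none. -/
def answers (n : ℕ) (E : Edges) : (last : ℕ → ℕ) → List ℕ → List ℕ
  | _, [] => []
  | last, v :: Q =>
      let r := nextNeighbor n E v (last v)
      r :: answers n E (Function.update last v (max (last v) r)) Q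

/-- `Opt-BA_n`: sample a graph, store it, answer all queries from it. -/
noncomputable def OptBA (n : ℕ) (Q : List ℕ) : PMF (List ℕ) :=
  (BA n).map fun E => answers n E (fun _ => 0) Q

/-! ### State of the on-the-fly generator -/

/-- Flag of a pointer in the pointers tree. -/
inductive Flag where
  | direct
  | recursive
  deriving DecidableEq

instance : Fintype Flag := ⟨{Flag.direct, Flag.recursive}, fun f => by cases f <;> simp⟩

instance : Nonempty Flag := ⟨Flag.direct⟩

/-- The memory of the generator. `none` is `nil`.
* `ptr j` is the pointer `u(j)` together with its flag;
* `front j` is the largest value found so far when searching for the children of `j`;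
* `heap j` is the heap of `j`, a list in nondecreasing order;
* `firstQuery j` tells whether there was no query on `j` yet. -/
structure State where
  ptr : ℕ → Option (ℕ × Flag)
  front : ℕ → Option ℕ
  heap : ℕ → List ℕ
  firstQuery : ℕ → Bool

namespace State

def init : State where
  ptr := fun _ => none
  front := fun _ => none
  heap := fun _ => []
  firstQuery := fun _ => true

def u (S : State) (j : ℕ) : Option ℕ := (S.ptr j).map Prod.fst

def flag (S : State) (j : ℕ) : Option Flag := (S.ptr j).map Prod.snd

/-- `child(j)`: the known children of `j`, and `n + 1`. -/
def child (S : State) (n j : ℕ) : Finset ℕ :=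
  insert (n + 1) ((Finset.Icc 1 n).filter fun i => j < i ∧ S.u i = some j)

/-- `succ(child(j), k)`: the least element of `child(j)` beyond `k`. -/
def succChild (S : State) (n j k : ℕ) : ℕ :=
  leastOr n ((S.child n j).filter fun i => k < i)

/-- `Φ(j)`: the vertices `i < j` with `front(i) = nil` or `front(i) < j`. -/
def Phi (S : State) (j : ℕ) : Finset ℕ :=
  (Finset.Ico 1 j).filter fun i => ∀ f ∈ S.front i, f < j

def phi (S : State) (j : ℕ) : ℕ := (S.Phi j).card

/-- `i ∈ K`: `front(i)` is defined, and no `l` has `front(l) = i`. -/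
def InK (S : State) (i : ℕ) : Prop :=
  S.front i ≠ none ∧ ∀ l, S.front l ≠ some i

open Classical in
/-- `[a, b) \ K`. -/
noncomputable def candidates (S : State) (a b : ℕ) : Finset ℕ :=
  (Finset.Ico a b).filter fun x => ¬ S.InK x

theorem mem_Ico_of_mem_candidates {S : State} {a b x : ℕ} (h : x ∈ S.candidates a b) :
    a ≤ x ∧ x < b := by
  classical
  exact Finset.mem_Ico.1 (Finset.mem_filter.1 h).1

def setPtr (S : State) (j i : ℕ) (f : Flag) : State :=
  { S with ptr := Function.update S.ptr j (some (i, f)) }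

def setFront (S : State) (j x : ℕ) : State :=
  { S with front := Function.update S.front j (some x) }

def setHeap (S : State) (j : ℕ) (h : List ℕ) : State :=
  { S with heap := Function.update S.heap j h }

def unsetFirstQuery (S : State) (j : ℕ) : State :=
  { S with firstQuery := Function.update S.firstQuery j false }

end State

/-- Randomized programs that use the memory of the generator. -/
abbrev Gen := StateT State PMF

/-- A random choice from a probability distribution. -/
noncomputable def choose {α : Type} (p : PMF α) : Gen α := StateT.lift p

/-! ### The procedure `toss` -/

/-- `P'_y` for `0 ≤ y ≤ t`: `P'_0 = 0`, `P'_t = 1`, and `P'_y = 1 - (ξ - 1) / (ξ + (y - 1))`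
in between. -/
noncomputable def cumulative (ξ t y : ℕ) : ℝ :=
  if y = 0 then 0
  else if y < t then 1 - ((ξ : ℝ) - 1) / ((ξ : ℝ) + ((y : ℝ) - 1))
  else 1

theorem cumulative_mono {ξ : ℕ} (hξ : 1 ≤ ξ) (t : ℕ) : Monotone (cumulative ξ t) := by
  have h1 : (1 : ℝ) ≤ ξ := by exact_mod_cast hξ
  refine monotone_nat_of_le_succ fun y => ?_
  unfold cumulative
  rw [if_neg (Nat.succ_ne_zero y)]
  rcases Nat.eq_zero_or_pos y with rfl | hy
  · simp only [if_true]
    split_ifs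
    · push_cast
      have : ((ξ : ℝ) - 1) / ((ξ : ℝ) + (0 + 1 - 1)) ≤ 1 :=
        div_le_one_of_le₀ (by linarith) (by linarith)
      linarith
    · norm_num
  · rw [if_neg hy.ne']
    have hy' : (1 : ℝ) ≤ y := by exact_mod_cast hy
    split_ifs with h2 h3 h3
    · push_cast
      have : ((ξ : ℝ) - 1) / ((ξ : ℝ) + ((y : ℝ) + 1 - 1)) ≤ ((ξ : ℝ) - 1) / (ξ + ((y : ℝ) - 1)) :=
        div_le_div_of_nonneg_left (by linarith) (by linarith) (by linarith)
      linarith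
    · have : 0 ≤ ((ξ : ℝ) - 1) / (ξ + ((y : ℝ) - 1)) :=
        div_nonneg (by linarith) (by linarith)
      linarith
    · omega
    · exact le_rfl

theorem sum_cumulative {ξ : ℕ} (hξ : 1 ≤ ξ) (s : ℕ) :
    ∑ y : Fin (s + 1),
      ENNReal.ofReal (cumulative ξ (s + 1) (y + 1) - cumulative ξ (s + 1) y) = 1 := by
  rw [Fin.sum_univ_eq_sum_range
    (fun y => ENNReal.ofReal (cumulative ξ (s + 1) (y + 1) - cumulative ξ (s + 1) y)) (s + 1),
    ← ENNReal.ofReal_sum_of_nonneg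
      (fun y _ => sub_nonneg.2 (cumulative_mono hξ (s + 1) (Nat.le_succ y))),
    Finset.sum_range_sub]
  simp [cumulative]

/-- `toss(ξ, s + 1)` returns the rank `y ∈ {0, …, s}` such that a uniformly random number
`H ∈ [0, 1)` satisfies `P'_y ≤ H < P'_{y+1}`; that is, `y` has probability `P'_{y+1} - P'_y`.
(It is only called with `ξ ≥ 1`.) -/
noncomputable def toss (ξ s : ℕ) : PMF (Fin (s + 1)) :=
  if hξ : 1 ≤ ξ then
    PMF.ofFintype
      (fun y => ENNReal.ofReal (cumulative ξ (s + 1) (y + 1) - cumulative ξ (s + 1) y))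
      (sum_cumulative hξ s)
  else PMF.pure (Fin.last s)

/-! ### The pointers tree generator -/

/-- `parent(j)`: the pointer of `j` and its flag. If they are not determined yet, the pointer is
drawn uniformly from `Φ(j)`, and the flag uniformly. In reachable states an undetermined pointer
has `Φ(j) = ∅` only for `j = 1`, which gets its self-loop, a direct pointer. -/
noncomputable def parent (j : ℕ) : Gen (ℕ × Flag) := do
  let S ← get
  match S.ptr j with
  | some p => return p
  | none =>
    if h : (S.Phi j).Nonempty then
      let i ← choose (PMF.uniformOfFinset (S.Phi j) h)
      let f ← choose (PMF.uniformOfFintype Flag)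
      set (S.setPtr j i f)
      return (i, f)
    else
      set (S.setPtr j j Flag.direct)
      return (j, Flag.direct)

/-- The loop of `next-child`: toss for a rank in `([a, b) \ K) ∪ {b}`. Stop if the rank is that
of `b`, or if the vertex `x` of that rank has no pointer yet; otherwise repeat with `x + 1`
in place of `a`. The memory does not change meanwhile. -/
noncomputable def search (S : State) (b a : ℕ) : PMF ℕ :=
  (toss (S.phi a) (S.candidates a b).card).bind fun h =>
    if hs : (h : ℕ) < (S.candidates a b).card then
      let x := (S.candidates a b).orderEmbOfFin rfl ⟨h, hs⟩
      if S.u x = none then PMF.pure x else search S b (x + 1)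
    else PMF.pure b
termination_by b - a
decreasing_by
  have hx := Finset.orderEmbOfFin_mem (S.candidates a b) rfl ⟨h, hs⟩
  have := State.mem_Ico_of_mem_candidates hx
  omega

/-- `next-child(j)`: the least child of `j` beyond `front(j)` (beyond `j`, if `front(j) = nil`).
Whenever `front(j)` moves to a vertex `x ≤ n` with `front(x) = nil`, the procedure calls itself
on `x`. (Always `j < x`; the test only shows that the recursion ends.) -/
noncomputable def nextChild (n j : ℕ) : Gen ℕ := do
  let _ ← parent j
  let S ← get
  if (S.front j).any (fun f => n ≤ f) then
    return n + 1
  else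
    let c := (S.front j).getD j
    let b := S.succChild n j c
    let x ← choose (search S b (c + 1))
    if x ≠ b then
      let f ← choose (PMF.uniformOfFintype Flag)
      modify fun S => S.setPtr x j f
    else
      pure ()
    modify fun S => S.setFront j x
    let S ← get
    if _h : j < x ∧ x ≤ n ∧ S.front x = none then
      let _ ← nextChild n x
      return x
    else
      return x
termination_by n - j
decreasing_by omega

/-- `next-child-from(j, k)`: the least child of `j` beyond `k`. -/
noncomputable def nextChildFrom (n j k : ℕ) : Gen ℕ := do
  if n ≤ k then
    return n + 1
  else
    let S ← get
    let q := S.succChild n j k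
    if (S.front j).any (fun f => q ≤ f) then
      return q
    else
      nextChild n j

/-- `next-child-tp(j, k, type)`: the least child of `j` beyond `k` whose flag is `type`.
(Always `k < x`; the test only shows that the loop ends.) -/
noncomputable def nextChildTp (n j k : ℕ) (type : Flag) : Gen ℕ := do
  let x ← nextChildFrom n j k
  let S ← get
  if _h : k < x ∧ x ≤ n ∧ S.flag x ≠ some type then
    nextChildTp n j x type
  else
    return x
termination_by n - k
decreasing_by omega

/-! ### The on-the-fly generator of BA-graphs -/

/-- `BA-parent(j)`: follow pointers until a direct one was used. (A recursive pointer of `j`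
always leads to some `i < j`; the test only shows that the recursion ends.) -/
noncomputable def baParent (j : ℕ) : Gen ℕ := do
  let p ← parent j
  if _h : p.1 < j ∧ p.2 = Flag.recursive then
    baParent p.1
  else
    return p.1
termination_by j
decreasing_by exact _h.1

/-- `heap-insert(heap_j, x)`. -/
noncomputable def heapInsert (j x : ℕ) : Gen Unit :=
  modify fun S => S.setHeap j (List.orderedInsert (· ≤ ·) x (S.heap j))

/-- `BA-next-neighbor(j)`. On its first query, vertex `1` is returned as its own neighbor (by the
self-loop, a direct pointer), so also the search for recursive pointers to it begins there. -/
noncomputable def baNextNeighbor (n j : ℕ) : Gen ℕ := do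
  let S ← get
  if S.firstQuery j then
    modify fun S => S.unsetFirstQuery j
    heapInsert j (n + 1)
    let x ← nextChildTp n j j Flag.direct
    heapInsert j x
    if j = 1 then
      let y ← nextChildTp n j j Flag.recursive
      heapInsert j y
    else
      pure ()
    baParent j
  else
    match S.heap j with
    | [] => return n + 1 -- never reached
    | r :: h =>
      modify fun S => S.setHeap j h
      if r = n + 1 then
        heapInsert j (n + 1)
        return n + 1
      else if S.flag r = some Flag.direct then
        let x ← nextChildTp n j r Flag.direct
        heapInsert j x
        let y ← nextChildTp n r r Flag.recursive
        heapInsert j y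
        return r
      else
        let p ← parent r
        let x ← nextChildTp n p.1 r Flag.recursive
        heapInsert j x
        let y ← nextChildTp n r r Flag.recursive
        heapInsert j y
        return r

/-- `O-t-F-BA_n`: starting from the empty memory, call `BA-next-neighbor` for each query. -/
noncomputable def OtFBA (n : ℕ) (Q : List ℕ) : PMF (List ℕ) :=
  StateT.run' (Q.mapM (baNextNeighbor n)) State.init

end BAGen

/-! A pointers tree `t` assigns a pointer and a flag to each vertex. Given the memory `S`, the
undetermined pointers are independent: that of `j` is uniform on Φ(j), with a fair flag. So the
conditional probability of `t` is the product `weight n S t`. The Barabási–Albert graph is the image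
of the unconditioned tree under `treeEdges` (`BA_eq_map_treeDist`): a uniform earlier vertex with a
fair flag picks a uniform end point of an edge, hence a degree-biased vertex.

The generator is then analysed along one fixed tree at a time. `Sim` says that some run along `t`
goes from `S` to `S'` with result `a`, and that weight(S, t) ≤ P(this run) · weight(S', t). Such
inequalities multiply under sequential composition. If along every `t` of positive weight the
program can output `g t`, then summing over `t` and over the final memories, whose weights have
total mass 1, gives P(g = a) ≤ P(output = a) for every `a`. Both sides are probability
distributions, so equality holds (`eq_of_apply_le`, `map_treeDist_eq_run'`). Only lower bounds for
one good run per tree are ever needed.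

Two points carry the argument. Probabilistic: moving front(j) past an undetermined vertex `y`
reveals that `j` is not its pointer, which costs the factor (φ(y)-1)/φ(y); the product of these
factors is what `toss` samples with one random number (`toss_succ_succ`, `le_search`,
`weight_le_of_advance`). Combinatorial: the heap of `j` holds, for each pointer and flag that leads
to the parent `j`, the first vertex beyond the last answer, so its minimum is the next neighbor
(`frontier_iff`, `HeapCorrect.next`). -/

namespace BAGen

/-! ### Least elements -/

/-- `x` is the least `y ≤ n` with `P y`, or `n + 1` if there is none. -/
structure Next (n : ℕ) (P : ℕ → Prop) (x : ℕ) : Prop where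
  le : x ≤ n + 1
  prop : x ≤ n → P x
  min : ∀ y ≤ n, P y → x ≤ y

theorem Next.unique {n : ℕ} {P : ℕ → Prop} {x x' : ℕ} (h : Next n P x) (h' : Next n P x') :
    x = x' := by
  rcases h with ⟨h1, h2, h3⟩
  rcases h' with ⟨g1, g2, g3⟩
  by_cases hx : x ≤ n <;> by_cases hx' : x' ≤ n
  · exact le_antisymm (h3 _ hx' (g2 hx')) (g3 _ hx (h2 hx))
  · have := g3 _ hx (h2 hx); omega
  · have := h3 _ hx' (g2 hx'); omega
  · omega

theorem Next.congr {n : ℕ} {P P' : ℕ → Prop} {x : ℕ} (h : Next n P x)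
    (hP : ∀ y ≤ n, P y ↔ P' y) : Next n P' x :=
  ⟨h.le, fun hx => (hP x hx).1 (h.prop hx), fun y hy hy' => h.min y hy ((hP y hy).2 hy')⟩

theorem next_leastOr {n : ℕ} {P : ℕ → Prop} {s : Finset ℕ} (h : ∀ y ≤ n, y ∈ s ↔ P y)
    (hs : ∀ y ∈ s, y ≤ n + 1) : Next n P (leastOr n s) := by
  unfold leastOr
  split_ifs with hne
  · exact ⟨hs _ (s.min'_mem hne), fun hx => (h _ hx).1 (s.min'_mem hne),
      fun y hy hy' => s.min'_le y ((h y hy).2 hy')⟩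
  · refine ⟨le_rfl, fun hx => by omega, fun y hy hy' => ?_⟩
    exact absurd ⟨y, (h y hy).2 hy'⟩ hne

theorem leastOr_eq {n : ℕ} {P : ℕ → Prop} {s : Finset ℕ} {x : ℕ} (h : ∀ y, y ∈ s ↔ y ≤ n ∧ P y)
    (hx : Next n P x) : leastOr n s = x := by
  refine (next_leastOr (P := P) (fun y hy => ?_) (fun y hy => ?_)).unique hx
  · rw [h]; tauto
  · have := (h y).1 hy; omega

theorem exists_next (n : ℕ) (P : ℕ → Prop) : ∃ x, Next n P x := by
  classical
  exact ⟨_, next_leastOr (s := (Finset.range (n + 1)).filter P)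
    (fun y hy => by simp; omega) (fun y hy => by simp at hy; omega)⟩

/-! ### The conditional distribution of the pointers tree -/

/-- A pointers tree: the pointer of each vertex with its flag. -/
abbrev Tree := ℕ → ℕ × Flag

/-- The conditional distribution of the pointer of `j` given the memory. -/
noncomputable def draw (S : State) (j : ℕ) : PMF (ℕ × Flag) :=
  match S.ptr j with
  | some p => PMF.pure p
  | none =>
    if h : (S.Phi j).Nonempty then
      (PMF.uniformOfFinset (S.Phi j) h).bind fun i =>
        (PMF.uniformOfFintype Flag).map fun f => (i, f)
    else PMF.pure (j, Flag.direct)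

theorem draw_of_ptr {S : State} {j : ℕ} {p : ℕ × Flag} (h : S.ptr j = some p) :
    draw S j = PMF.pure p := by
  simp [draw, h]

theorem draw_of_empty {S : State} {j : ℕ} (h : S.ptr j = none) (hj : ¬ (S.Phi j).Nonempty) :
    draw S j = PMF.pure (j, Flag.direct) := by
  simp [draw, h, hj]

theorem uniformFlag_apply (f : Flag) : PMF.uniformOfFintype Flag f = 2⁻¹ := by
  rw [PMF.uniformOfFintype_apply]
  rfl

theorem draw_of_nonempty {S : State} {j : ℕ} (h : S.ptr j = none) (hj : (S.Phi j).Nonempty)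
    (p : ℕ × Flag) :
    draw S j p = if p.1 ∈ S.Phi j then (S.phi j : ENNReal)⁻¹ * 2⁻¹ else 0 := by
  classical
  obtain ⟨i, f⟩ := p
  have hd : draw S j = (PMF.uniformOfFinset (S.Phi j) hj).bind fun i =>
        (PMF.uniformOfFintype Flag).map fun f => (i, f) := by
    simp [draw, h, hj]
  rw [hd, PMF.bind_apply, tsum_eq_single i]
  · rw [PMF.map_apply, tsum_eq_single f]
    · simp only [PMF.uniformOfFinset_apply, uniformFlag_apply, State.phi]
      split_ifs <;> simp_all
    · intro f' hf'
      simp [Ne.symm hf']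
  · intro i' hi'
    rw [PMF.map_apply]
    simp [Ne.symm hi']

/-- The conditional probability of the tree `t` given the memory. -/
noncomputable def weight (n : ℕ) (S : State) (t : Tree) : ENNReal :=
  ∏ j ∈ Finset.Icc 1 n, draw S j (t j)

theorem weight_congr {n : ℕ} {S S' : State} {t : Tree} (hp : S'.ptr = S.ptr)
    (hf : S'.front = S.front) : weight n S' t = weight n S t := by
  unfold weight draw State.Phi
  simp only [hp, hf]

/-- The conditional distribution of the tree given the memory. -/
noncomputable def treeDist (S : State) : ℕ → PMF Tree
  | 0 => PMF.pure fun _ => (0, Flag.direct)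
  | n + 1 => (treeDist S n).bind fun t => (draw S (n + 1)).map fun p => Function.update t (n + 1) p

theorem treeDist_default {S : State} {n : ℕ} {t : Tree} (h : treeDist S n t ≠ 0) :
    ∀ j, n < j → t j = (0, Flag.direct) := by
  induction n generalizing t with
  | zero =>
    simp only [treeDist, PMF.pure_apply, ne_eq, ite_eq_right_iff, one_ne_zero, imp_false,
      not_not] at h
    simp [h]
  | succ n ih =>
    rw [← PMF.mem_support_iff, treeDist, PMF.mem_support_bind_iff] at h
    obtain ⟨t', ht', h⟩ := h
    rw [PMF.mem_support_map_iff] at h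
    obtain ⟨p, -, rfl⟩ := h
    intro j hj
    rw [Function.update_of_ne (by omega)]
    exact ih ((PMF.mem_support_iff _ _).1 ht') j (by omega)

open Classical in
-- Pinning the values outside `1, …, n` to a default turns `weight` into a mass function on trees.
-- `weight` is convenient along programs; `treeDist` supplies the total mass 1 for the final
-- summation.
theorem treeDist_apply (S : State) (n : ℕ) (t : Tree) :
    treeDist S n t =
      if ∀ j, j ∉ Finset.Icc 1 n → t j = (0, Flag.direct) then weight n S t else 0 := by
  induction n generalizing t with
  | zero =>
    simp only [treeDist, PMF.pure_apply, weight]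
    simp [funext_iff]
  | succ n ih =>
    -- The only tree on `n` vertices whose extension at `n + 1` can equal `t`, hence the only
    -- surviving term of the sum.
    set t' : Tree := Function.update t (n + 1) (0, Flag.direct) with ht'
    rw [treeDist, PMF.bind_apply, tsum_eq_single t', PMF.map_apply, tsum_eq_single (t (n + 1))]
    · rw [if_pos (by simp [ht']), ih]
      have h1 : (∀ j, j ∉ Finset.Icc 1 n → t' j = (0, Flag.direct)) ↔
          ∀ j, j ∉ Finset.Icc 1 (n + 1) → t j = (0, Flag.direct) := by
        constructor
        · intro h j hj
          have h2 := h j (by simp at hj ⊢; omega)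
          rwa [ht', Function.update_of_ne (by simp at hj; omega)] at h2
        · intro h j hj
          by_cases hj' : j = n + 1
          · simp [ht', hj']
          · rw [ht', Function.update_of_ne hj']
            exact h j (by simp at hj ⊢; omega)
      have h2 : weight (n + 1) S t = weight n S t' * draw S (n + 1) (t (n + 1)) := by
        unfold weight
        rw [Finset.prod_Icc_succ_top (by omega)]
        congr 1
        refine Finset.prod_congr rfl fun j hj => ?_
        rw [ht', Function.update_of_ne (by simp at hj; omega)]
      simp only [h1, h2]
      split_ifs <;> simp
    · intro p hp
      rw [if_neg]
      intro h
      exact hp (by simpa using (congrFun h (n + 1)).symm)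
    · intro s hs
      by_cases hs0 : treeDist S n s = 0
      · simp [hs0]
      · have hd := treeDist_default hs0
        rw [PMF.map_apply]
        simp only [mul_eq_zero, hs0, false_or, ENNReal.tsum_eq_zero, ite_eq_right_iff]
        rintro p rfl
        exfalso
        apply hs
        rw [ht', Function.update_idem]
        symm
        rw [Function.update_eq_self_iff]
        exact (hd _ (by omega)).symm

/-! ### Simulation of a program along a fixed tree -/

/-- Along the tree `t`, the program may turn `S` into `S'` with result `a`, and it does so with
at least the probability required by the conditional probabilities of `t`. -/
def Sim (n : ℕ) (t : Tree) {α : Type} (op : Gen α) (S : State) (a : α) (S' : State) : Prop :=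
  weight n S t ≤ op.run S (a, S') * weight n S' t

/-- The right side is a sum over intermediate results and memories; the left side is one of its
terms. -/
theorem le_run_bind {α β : Type} (x : Gen α) (f : α → Gen β) (S S' S'' : State) (a : α) (b : β) :
    x.run S (a, S') * (f a).run S' (b, S'') ≤ (x >>= f).run S (b, S'') := by
  change _ ≤ ((x.run S).bind fun p => (f p.1).run p.2) (b, S'')
  rw [PMF.bind_apply]
  exact ENNReal.le_tsum (f := fun p : α × State => x.run S p * (f p.1).run p.2 (b, S'')) (a, S')

section Sim

variable {n : ℕ} {t : Tree} {α β : Type}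

theorem Sim.pure (a : α) (S : State) : Sim n t (pure a : Gen α) S a S := by
  unfold Sim
  have : (Pure.pure a : Gen α).run S (a, S) = 1 := by
    change (PMF.pure (a, S)) (a, S) = 1
    simp
  rw [this, one_mul]

theorem Sim.bind {x : Gen α} {f : α → Gen β} {S S' S'' : State} {a : α} {b : β}
    (hx : Sim n t x S a S') (hf : Sim n t (f a) S' b S'') : Sim n t (x >>= f) S b S'' := by
  unfold Sim at *
  calc weight n S t ≤ x.run S (a, S') * weight n S' t := hx
    _ ≤ x.run S (a, S') * ((f a).run S' (b, S'') * weight n S'' t) := by gcongr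
    _ = x.run S (a, S') * (f a).run S' (b, S'') * weight n S'' t := by rw [mul_assoc]
    _ ≤ _ := by
      gcongr
      exact le_run_bind x f S S' S'' a b

theorem Sim.get_bind {f : State → Gen β} {S S' : State} {b : β} (hf : Sim n t (f S) S b S') :
    Sim n t (get >>= f) S b S' := by
  refine Sim.bind (a := S) (S' := S) ?_ hf
  unfold Sim
  have : (get : Gen State).run S (S, S) = 1 := by
    change (PMF.pure (S, S)) (S, S) = 1
    simp
  rw [this, one_mul]

theorem run_set (S S' : State) : (set S' : Gen PUnit).run S (PUnit.unit, S') = 1 := by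
  change (PMF.pure (PUnit.unit, S')) (PUnit.unit, S') = 1
  simp

theorem run_modify (g : State → State) (S : State) :
    (modify g : Gen PUnit).run S (PUnit.unit, g S) = 1 := by
  change (PMF.pure (PUnit.unit, g S)) (PUnit.unit, g S) = 1
  simp

theorem Sim.modify (g : State → State) (S : State) (hp : (g S).ptr = S.ptr)
    (hf : (g S).front = S.front) : Sim n t (modify g : Gen PUnit) S PUnit.unit (g S) := by
  unfold Sim
  rw [run_modify, one_mul, weight_congr hp hf]

/-- Positive weight of `t` is inherited by every memory reached along `t`, so consistency with `t`
never needs a separate invariant. -/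
theorem Sim.weight_ne_zero {x : Gen α} {S S' : State} {a : α} (h : Sim n t x S a S')
    (hS : weight n S t ≠ 0) : weight n S' t ≠ 0 := by
  intro h0
  apply hS
  have h' : weight n S t ≤ _ := h
  rw [h0, mul_zero] at h'
  simpa using h'

theorem run_choose (p : PMF α) (S : State) (a : α) : (choose p).run S (a, S) = p a := by
  change (p.bind fun a => PMF.pure (a, S)) (a, S) = p a
  rw [PMF.bind_apply, tsum_eq_single a]
  · simp
  · intro b hb
    simp [Ne.symm hb]

end Sim

/-! ### Invariants of the memory -/

/-- The invariant of the memory; `e` is a vertex that may be a front while having no front. -/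
structure Inv (n : ℕ) (S : State) (e : ℕ) : Prop where
  pos : ∀ i f, S.front i = some f → 1 ≤ i
  lt : ∀ i f, S.front i = some f → i < f
  u_front : ∀ i f, S.front i = some f → f ≤ n → S.u f = some i
  ptr_ne : ∀ i, S.front i ≠ none → S.ptr i ≠ none
  chain : ∀ i f, S.front i = some f → f ≤ n → f ≠ e → S.front f ≠ none

/-- The exception `e = 0` means no exception, because a front is larger than its index and so never
`0`. -/
theorem Inv.weaken {n : ℕ} {S : State} {e : ℕ} (h : Inv n S 0) : Inv n S e :=
  ⟨h.pos, h.lt, h.u_front, h.ptr_ne, fun i f hf hn _ =>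
    h.chain i f hf hn (by have := h.lt i f hf; omega)⟩

theorem Inv.strengthen {n : ℕ} {S : State} {e : ℕ} (h : Inv n S e) (he : S.front e ≠ none) :
    Inv n S 0 :=
  ⟨h.pos, h.lt, h.u_front, h.ptr_ne, fun i f hf hn _ => by
    by_cases hfe : f = e
    · rwa [hfe]
    · exact h.chain i f hf hn hfe⟩

/-! ### Φ and the candidate set from one vertex to the next -/

namespace State

theorem mem_Phi {S : State} {i j : ℕ} :
    i ∈ S.Phi j ↔ (1 ≤ i ∧ i < j) ∧ ∀ f, S.front i = some f → f < j := by
  simp [Phi]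

/-- No vertex has front `y`, so no smaller vertex enters at `y + 1`; and `y` itself stays out
because its front exceeds `y`. -/
theorem Phi_succ_of_inK {n : ℕ} {S : State} {e y : ℕ} (h : Inv n S e) (hy : S.InK y) :
    S.Phi (y + 1) = S.Phi y := by
  ext i
  rw [mem_Phi, mem_Phi]
  constructor
  · rintro ⟨⟨h1, h2⟩, h3⟩
    have hne : i ≠ y := by
      rintro rfl
      obtain ⟨f, hf⟩ := Option.ne_none_iff_exists'.1 hy.1
      have := h3 f hf
      have := h.lt _ _ hf
      omega
    refine ⟨⟨h1, by omega⟩, fun f hf => ?_⟩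
    have := h3 f hf
    have : f ≠ y := fun hfy => hy.2 i (hfy ▸ hf)
    omega
  · rintro ⟨⟨h1, h2⟩, h3⟩
    exact ⟨⟨h1, by omega⟩, fun f hf => by have := h3 f hf; omega⟩

/-- Exactly one vertex enters Φ. If front(y) is undefined it is `y`, and by `chain` no front equals
`y`. Otherwise it is the vertex `l` with front `y`, unique because then the pointer of `y` is `l`.
-/
theorem phi_succ_of_not_inK {n : ℕ} {S : State} {e y : ℕ} (h : Inv n S e) (hy : ¬ S.InK y)
    (hye : y ≠ e) (hyn : y ≤ n) (hy1 : 1 ≤ y) : S.phi (y + 1) = S.phi y + 1 := by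
  unfold phi
  by_cases hf : S.front y = none
  · have hno : ∀ l, S.front l ≠ some y := fun l hl => h.chain l y hl hyn hye hf
    have : S.Phi (y + 1) = insert y (S.Phi y) := by
      ext i
      rw [Finset.mem_insert, mem_Phi, mem_Phi]
      constructor
      · rintro ⟨⟨h1, h2⟩, h3⟩
        by_cases hiy : i = y
        · exact Or.inl hiy
        · refine Or.inr ⟨⟨h1, by omega⟩, fun f hf' => ?_⟩
          have := h3 f hf'
          have : f ≠ y := fun hfy => hno i (hfy ▸ hf')
          omega
      · rintro (rfl | ⟨⟨h1, h2⟩, h3⟩)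
        · exact ⟨⟨hy1, by omega⟩, by simp [hf]⟩
        · exact ⟨⟨h1, by omega⟩, fun f hf => by have := h3 f hf; omega⟩
    rw [this, Finset.card_insert_of_notMem (by simp [mem_Phi])]
  · obtain ⟨l, hl⟩ : ∃ l, S.front l = some y := by
      by_contra! hl
      exact hy ⟨hf, hl⟩
    have hly := h.lt _ _ hl
    have hl1 := h.pos _ _ hl
    have hlu := h.u_front _ _ hl hyn
    have : S.Phi (y + 1) = insert l (S.Phi y) := by
      ext i
      rw [Finset.mem_insert, mem_Phi, mem_Phi]
      constructor
      · rintro ⟨⟨h1, h2⟩, h3⟩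
        by_cases hil : i = l
        · exact Or.inl hil
        · have hiy : i ≠ y := by
            rintro rfl
            obtain ⟨f, hf⟩ := Option.ne_none_iff_exists'.1 hf
            have := h3 f hf
            have := h.lt _ _ hf
            omega
          refine Or.inr ⟨⟨h1, by omega⟩, fun f hf' => ?_⟩
          have := h3 f hf'
          have : f ≠ y := by
            rintro rfl
            have := h.u_front _ _ hf' hyn
            rw [hlu] at this
            exact hil (by simpa using this.symm)
          omega
      · rintro (rfl | ⟨⟨h1, h2⟩, h3⟩)
        · refine ⟨⟨hl1, by omega⟩, fun f hf => ?_⟩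
          rw [hl] at hf
          have : y = f := by simpa using hf
          omega
        · exact ⟨⟨h1, by omega⟩, fun f hf => by have := h3 f hf; omega⟩
    rw [this, Finset.card_insert_of_notMem]
    rw [mem_Phi]
    rintro ⟨-, h3⟩
    exact absurd (h3 y hl) (lt_irrefl _)

theorem candidates_of_inK {S : State} {a b : ℕ} (h : S.InK a) :
    S.candidates a b = S.candidates (a + 1) b := by
  ext x
  simp only [candidates, Finset.mem_filter, Finset.mem_Ico]
  constructor
  · rintro ⟨⟨h1, h2⟩, h3⟩
    have : x ≠ a := by rintro rfl; exact h3 h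
    exact ⟨⟨by omega, h2⟩, h3⟩
  · rintro ⟨⟨h1, h2⟩, h3⟩
    exact ⟨⟨by omega, h2⟩, h3⟩

theorem candidates_of_not_inK {S : State} {a b : ℕ} (h : ¬ S.InK a) (hab : a < b) :
    S.candidates a b = insert a (S.candidates (a + 1) b) := by
  ext x
  simp only [candidates, Finset.mem_filter, Finset.mem_Ico, Finset.mem_insert]
  constructor
  · rintro ⟨⟨h1, h2⟩, h3⟩
    by_cases hx : x = a
    · exact Or.inl hx
    · exact Or.inr ⟨⟨by omega, h2⟩, h3⟩
  · rintro (rfl | ⟨⟨h1, h2⟩, h3⟩)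
    · exact ⟨⟨le_rfl, hab⟩, h⟩
    · exact ⟨⟨by omega, h2⟩, h3⟩

end State

/-! ### Tossing and searching -/

theorem toss_apply {ξ : ℕ} (hξ : 1 ≤ ξ) (s : ℕ) (y : Fin (s + 1)) :
    toss ξ s y = ENNReal.ofReal (cumulative ξ (s + 1) (y + 1) - cumulative ξ (s + 1) y) := by
  simp only [toss, dif_pos hξ, PMF.ofFintype_apply]

theorem cumulative_zero (ξ t : ℕ) : cumulative ξ t 0 = 0 := by
  simp [cumulative]

theorem cumulative_succ_of_lt {ξ t y : ℕ} (h : y + 1 < t) :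
    cumulative ξ t (y + 1) = 1 - ((ξ : ℝ) - 1) / ((ξ : ℝ) + y) := by
  simp [cumulative, h]

theorem cumulative_succ_of_le {ξ t y : ℕ} (h : t ≤ y + 1) : cumulative ξ t (y + 1) = 1 := by
  simp [cumulative, h]

theorem toss_succ_zero {ξ : ℕ} (hξ : 1 ≤ ξ) (s : ℕ) :
    toss ξ (s + 1) 0 = (ξ : ENNReal)⁻¹ := by
  have h1 : (1 : ℝ) ≤ ξ := by exact_mod_cast hξ
  rw [toss_apply hξ, Fin.val_zero, cumulative_zero, cumulative_succ_of_lt (by omega),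
    ← ENNReal.ofReal_natCast ξ, ← ENNReal.ofReal_inv_of_pos (by linarith)]
  congr 1
  push_cast
  rw [add_zero]
  field_simp
  ring

/-- A toss is a chain of trials: rank 0 is rejected with probability (ξ-1)/ξ, and the remaining
ranks are tossed for with ξ+1. This matches φ growing by one at each candidate. -/
theorem toss_succ_succ {ξ : ℕ} (hξ : 1 ≤ ξ) (s : ℕ) (y : Fin (s + 1)) :
    toss ξ (s + 1) y.succ = ((ξ - 1 : ℕ) / ξ : ENNReal) * toss (ξ + 1) s y := by
  have h1 : (1 : ℝ) ≤ ξ := by exact_mod_cast hξ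
  have hr : ((ξ - 1 : ℕ) / ξ : ENNReal) = ENNReal.ofReal ((ξ - 1) / ξ) := by
    rw [ENNReal.ofReal_div_of_pos (by linarith), ENNReal.ofReal_natCast]
    congr 1
    rw [← ENNReal.ofReal_natCast]
    push_cast [hξ]
    rfl
  -- Up to rearrangement: the tail probabilities `1 - cumulative` factor through the first
  -- rejection.
  have key : ∀ z : ℕ, cumulative ξ (s + 1 + 1) (z + 1) =
      1 - (ξ - 1) / ξ * (1 - cumulative (ξ + 1) (s + 1) z) := by
    intro z
    rcases z with _ | z
    · rw [cumulative_zero, cumulative_succ_of_lt (by omega)]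
      push_cast
      ring
    · by_cases hzs : z + 1 < s + 1
      · rw [cumulative_succ_of_lt (by omega), cumulative_succ_of_lt hzs]
        push_cast
        have : (ξ : ℝ) + (z + 1) ≠ 0 := by positivity
        have : (ξ : ℝ) + 1 + z ≠ 0 := by positivity
        have : (ξ : ℝ) ≠ 0 := by positivity
        field_simp
        ring
      · rw [cumulative_succ_of_le (by omega), cumulative_succ_of_le (by omega)]
        ring
  rw [toss_apply hξ, toss_apply (by omega), hr, ← ENNReal.ofReal_mul (by
    apply div_nonneg <;> linarith), Fin.val_succ, key, key]
  congr 1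
  ring

theorem search_eq_pure (S : State) (b : ℕ) : search S b b = PMF.pure b := by
  have hc : (S.candidates b b).card = 0 := by simp [State.candidates]
  rw [search]
  have : ∀ h : Fin ((S.candidates b b).card + 1), ¬ (h : ℕ) < (S.candidates b b).card := by
    intro h; omega
  simp only [this, dite_false, PMF.bind_const]

/-- One round of `search` with the candidates given as a parameter. -/
theorem search_apply (S : State) (b a x : ℕ) (s : Finset ℕ) (hs : S.candidates a b = s)
    (k : ℕ) (hk : s.card = k) :
    search S b a x = ∑ h : Fin (k + 1), toss (S.phi a) k h *
      (if hh : (h : ℕ) < k then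
        (if S.u (s.orderEmbOfFin hk ⟨h, hh⟩) = none then PMF.pure (s.orderEmbOfFin hk ⟨h, hh⟩)
          else search S b (s.orderEmbOfFin hk ⟨h, hh⟩ + 1))
      else PMF.pure b) x := by
  subst hs hk
  conv_lhs => rw [search]
  rw [PMF.bind_apply, tsum_fintype]

/-- A vertex of K alters neither φ nor the candidates, so the scan may start one vertex later. -/
theorem search_of_inK {n : ℕ} {S : State} {e a b : ℕ} (hI : Inv n S e) (h : S.InK a) :
    search S b a = search S b (a + 1) := by
  have hphi : S.phi (a + 1) = S.phi a := by unfold State.phi; rw [State.Phi_succ_of_inK hI h]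
  ext x
  rw [search_apply S b a x _ (State.candidates_of_inK h) _ rfl, search_apply S b (a + 1) x _ rfl _ rfl,
    hphi]

theorem orderEmbOfFin_insert_zero {s : Finset ℕ} {a k : ℕ} (ha : ∀ x ∈ s, a < x)
    (hk : (insert a s).card = k) (h0 : 0 < k) : (insert a s).orderEmbOfFin hk ⟨0, h0⟩ = a := by
  rw [Finset.orderEmbOfFin_zero hk h0]
  refine le_antisymm (Finset.min'_le _ _ (Finset.mem_insert_self _ _)) ?_
  refine Finset.le_min' _ _ _ fun y hy => ?_
  rcases Finset.mem_insert.1 hy with rfl | hy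
  · exact le_rfl
  · exact (ha y hy).le

theorem orderEmbOfFin_insert_succ {s : Finset ℕ} {a k : ℕ} (ha : ∀ x ∈ s, a < x)
    (hs : s.card = k) (hk : (insert a s).card = k + 1) (i : Fin k) :
    (insert a s).orderEmbOfFin hk i.succ = s.orderEmbOfFin hs i := by
  have hmono : StrictMono fun i : Fin k => (insert a s).orderEmbOfFin hk i.succ := by
    intro x y hxy
    exact ((insert a s).orderEmbOfFin hk).strictMono (Fin.succ_lt_succ_iff.2 hxy)
  have := Finset.orderEmbOfFin_unique hs (f := fun i : Fin k =>
    (insert a s).orderEmbOfFin hk i.succ) (fun x => ?_) hmono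
  · exact congrFun this i
  · have hm := Finset.orderEmbOfFin_mem (insert a s) hk x.succ
    rcases Finset.mem_insert.1 hm with hm | hm
    · exfalso
      have h0 := orderEmbOfFin_insert_zero ha hk (Nat.succ_pos k)
      have hlt : (insert a s).orderEmbOfFin hk ⟨0, Nat.succ_pos k⟩ <
          (insert a s).orderEmbOfFin hk x.succ :=
        ((insert a s).orderEmbOfFin hk).strictMono (Fin.succ_pos x)
      omega
    · exact hm

/-- The single toss is unrolled into a vertex-by-vertex scan: `a` is hit with probability 1/φ(a),
and otherwise the toss continues as one that starts at `a + 1`. -/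
theorem search_of_not_inK {n : ℕ} {S : State} {e a b : ℕ} (hI : Inv n S e) (h : ¬ S.InK a)
    (hab : a < b) (hbn : b ≤ n + 1) (hae : a ≠ e) (ha1 : 1 ≤ a) (hphi : 1 ≤ S.phi a) (x : ℕ) :
    search S b a x =
      (S.phi a : ENNReal)⁻¹ * (if S.u a = none then PMF.pure a else search S b (a + 1)) x +
        ((S.phi a - 1 : ℕ) / S.phi a : ENNReal) * search S b (a + 1) x := by
  have hlt : ∀ x ∈ S.candidates (a + 1) b, a < x := fun x hx => by
    have := State.mem_Ico_of_mem_candidates hx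
    omega
  obtain ⟨k, hk⟩ : ∃ k, (S.candidates (a + 1) b).card = k := ⟨_, rfl⟩
  have hk' : (insert a (S.candidates (a + 1) b)).card = k + 1 := by
    rw [Finset.card_insert_of_notMem, hk]
    intro hm
    exact absurd (hlt a hm) (lt_irrefl _)
  rw [search_apply S b a x _ (State.candidates_of_not_inK h hab) _ hk', Fin.sum_univ_succ]
  congr 1
  · rw [toss_succ_zero hphi]
    congr 1
    exact congrArg (fun y => (if S.u y = none then PMF.pure y else search S b (y + 1)) x)
      (orderEmbOfFin_insert_zero hlt hk' (Nat.succ_pos k))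
  · rw [search_apply S b (a + 1) x _ rfl _ hk, Finset.mul_sum]
    refine Finset.sum_congr rfl fun i _ => ?_
    rw [toss_succ_succ hphi, State.phi_succ_of_not_inK hI h hae (by omega) ha1, mul_assoc]
    congr 2
    by_cases hi : (i : ℕ) < k
    · have hi' : ((i.succ : Fin (k + 2)) : ℕ) < k + 1 := by simp; omega
      rw [dif_pos hi, dif_pos hi']
      have := orderEmbOfFin_insert_succ hlt hk hk' ⟨i, hi⟩
      have e : (⟨(i.succ : Fin (k + 2)), hi'⟩ : Fin (k + 1)) = Fin.succ ⟨i, hi⟩ := rfl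
      rw [e, this]
    · have hi' : ¬ ((i.succ : Fin (k + 2)) : ℕ) < k + 1 := by simp; omega
      rw [dif_neg hi, dif_neg hi']

open Classical in
/-- The contribution of the vertex `y` to the probability that the search ends at `x`. -/
noncomputable def searchFactor (S : State) (y : ℕ) : ENNReal :=
  if S.ptr y = none then ((S.phi y - 1 : ℕ) / S.phi y : ENNReal) else 1

open Classical in
-- Induction along the scan from `a` to `x`. At an undetermined vertex only the branch passing over
-- it is kept. At a vertex outside K with known pointer, a hit restarts the search at the next
-- vertex, so both branches continue there and their probabilities add up to 1.
theorem le_search {n : ℕ} {S : State} {e b x : ℕ} (hI : Inv n S e) (hbn : b ≤ n + 1)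
    (hxb : x = b ∨ x < b ∧ S.ptr x = none) (a : ℕ) (ha : e < a) (hax : a ≤ x)
    (hphi : ∀ y, a ≤ y → y < b → 1 ≤ S.phi y) :
    (∏ y ∈ Finset.Ico a x, searchFactor S y) * (if x < b then (S.phi x : ENNReal)⁻¹ else 1) ≤
      search S b a x := by
  obtain ⟨d, hd⟩ : ∃ d, x = a + d := ⟨x - a, by omega⟩
  induction d generalizing a with
  | zero =>
    obtain rfl : x = a := by omega
    rcases hxb with rfl | ⟨hxb, hx⟩
    · simp [search_eq_pure]
    · have hK : ¬ S.InK x := fun hK => hI.ptr_ne x hK.1 hx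
      rw [search_of_not_inK hI hK hxb hbn (by omega) (by omega) (hphi x le_rfl hxb)]
      have : S.u x = none := by simp [State.u, hx]
      simp [hxb, this]
  | succ d ih =>
    have hab : a < b := by omega
    have := ih (a + 1) (by omega) (by omega) (fun y hy hy' => hphi y (by omega) hy') (by omega)
    rw [Finset.prod_eq_prod_Ico_succ_bot (by omega), mul_assoc]
    refine (mul_le_mul_right this _).trans ?_
    by_cases hK : S.InK a
    · rw [search_of_inK hI hK, searchFactor, if_neg (hI.ptr_ne a hK.1), one_mul]
    · have h1 := hphi a le_rfl hab
      rw [search_of_not_inK hI hK hab hbn (by omega) (by omega) h1]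
      by_cases hp : S.ptr a = none
      · rw [searchFactor, if_pos hp]
        exact le_add_self
      · have hu : S.u a ≠ none := by simpa [State.u] using hp
        rw [searchFactor, if_neg hp, if_neg hu, ← add_mul]
        gcongr
        rw [← one_div, ← ENNReal.add_div, ENNReal.le_div_iff_mul_le (by simp) (by simp)]
        rw [one_mul, ← Nat.cast_one, ← Nat.cast_add]
        exact_mod_cast (by omega)

/-! ### Trees that are consistent with the memory -/

/-- A pointers tree that may occur. -/
structure IsTree (n : ℕ) (t : Tree) : Prop where
  root : t 1 = (1, Flag.direct)
  pos : ∀ j, 2 ≤ j → j ≤ n → 1 ≤ (t j).1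
  lt : ∀ j, 2 ≤ j → j ≤ n → (t j).1 < j

/-- `S'` knows at least as much about the tree as `S`. -/
structure Ext (S S' : State) : Prop where
  ptr : ∀ y p, S.ptr y = some p → S'.ptr y = some p
  front : ∀ j f, S.front j = some f → ∃ f', S'.front j = some f' ∧ f ≤ f'

/-- `S'` knows at least as much about the tree as `S` and agrees with it otherwise. -/
structure Frame (S S' : State) : Prop extends Ext S S' where
  heap : S'.heap = S.heap
  firstQuery : S'.firstQuery = S.firstQuery

theorem Ext.refl (S : State) : Ext S S := ⟨fun _ _ h => h, fun _ f h => ⟨f, h, le_rfl⟩⟩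

theorem Ext.trans {S S' S'' : State} (h : Ext S S') (h' : Ext S' S'') : Ext S S'' :=
  ⟨fun y p hp => h'.ptr y p (h.ptr y p hp), fun j f hf => by
    obtain ⟨f', hf', hle⟩ := h.front j f hf
    obtain ⟨f'', hf'', hle'⟩ := h'.front j f' hf'
    exact ⟨f'', hf'', hle.trans hle'⟩⟩

theorem Frame.refl (S : State) : Frame S S := ⟨Ext.refl S, rfl, rfl⟩

theorem Frame.trans {S S' S'' : State} (h : Frame S S') (h' : Frame S' S'') : Frame S S'' :=
  ⟨h.toExt.trans h'.toExt, h'.heap.trans h.heap, h'.firstQuery.trans h.firstQuery⟩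

section Consistent

variable {n : ℕ} {t : Tree} {S : State}

theorem draw_ne_zero (hW : weight n S t ≠ 0) {y : ℕ} (hy1 : 1 ≤ y) (hyn : y ≤ n) :
    draw S y (t y) ≠ 0 :=
  Finset.prod_ne_zero_iff.1 hW y (Finset.mem_Icc.2 ⟨hy1, hyn⟩)

theorem eq_of_ptr (hW : weight n S t ≠ 0) {y : ℕ} {p : ℕ × Flag} (hy1 : 1 ≤ y) (hyn : y ≤ n)
    (hp : S.ptr y = some p) : t y = p := by
  have := draw_ne_zero hW hy1 hyn
  rw [draw_of_ptr hp] at this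
  by_contra h
  simp [h] at this

theorem mem_Phi_of_ptr (hT : IsTree n t) (hW : weight n S t ≠ 0) {y : ℕ} (hy2 : 2 ≤ y)
    (hyn : y ≤ n) (hp : S.ptr y = none) : (t y).1 ∈ S.Phi y := by
  have := draw_ne_zero hW (by omega) hyn
  by_cases hne : (S.Phi y).Nonempty
  · rw [draw_of_nonempty hp hne] at this
    by_contra h
    simp [h] at this
  · rw [draw_of_empty hp hne] at this
    by_cases h : t y = (y, Flag.direct)
    · have := hT.lt y hy2 hyn
      rw [h] at this
      exact absurd this (lt_irrefl _)
    · simp [h] at this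

/-- An undetermined pointer lies in Φ(y), which excludes every vertex whose front is at least `y`.
So all children up to the front are already in memory. -/
theorem ptr_of_le_front (hT : IsTree n t) (hW : weight n S t ≠ 0) {y f : ℕ} (hy2 : 2 ≤ y)
    (hyn : y ≤ n) (hf : S.front (t y).1 = some f) (hyf : y ≤ f) : S.ptr y = some (t y) := by
  cases hp : S.ptr y with
  | some p => rw [eq_of_ptr hW (by omega) hyn hp]
  | none =>
    have := (State.mem_Phi.1 (mem_Phi_of_ptr hT hW hy2 hyn hp)).2 f hf
    omega

theorem u_eq_iff (hW : weight n S t ≠ 0) {y j : ℕ} (hy1 : 1 ≤ y) (hyn : y ≤ n) :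
    S.u y = some j ↔ S.ptr y = some (t y) ∧ (t y).1 = j := by
  unfold State.u
  constructor
  · intro h
    obtain ⟨p, hp, hpj⟩ := Option.map_eq_some_iff.1 h
    have := eq_of_ptr hW hy1 hyn hp
    subst this
    exact ⟨hp, hpj⟩
  · rintro ⟨h, rfl⟩
    rw [h]
    rfl

theorem next_succChild (S : State) (j k : ℕ) :
    Next n (fun y => k < y ∧ j < y ∧ S.u y = some j) (S.succChild n j k) := by
  unfold State.succChild State.child
  refine next_leastOr (fun y hy => ?_) (fun y hy => ?_)
  · simp only [Finset.mem_filter, Finset.mem_insert, Finset.mem_Icc]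
    constructor
    · rintro ⟨h1 | h1, h2⟩
      · omega
      · exact ⟨h2, h1.2⟩
    · rintro ⟨h1, h2⟩
      exact ⟨Or.inr ⟨⟨by omega, hy⟩, h2⟩, h1⟩
  · simp only [Finset.mem_filter, Finset.mem_insert, Finset.mem_Icc] at hy
    omega

end Consistent

theorem draw_congr {S S' : State} {y : ℕ} (hp : S'.ptr y = S.ptr y) (hf : S'.Phi y = S.Phi y) :
    draw S' y = draw S y := by
  unfold draw
  simp only [hp, hf]

theorem draw_eq_of_ptr {S : State} {y : ℕ} {p : ℕ × Flag} (h : S.ptr y = some p) :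
    draw S y p = 1 := by
  simp [draw_of_ptr h]

/-! ### Weighted simulation -/

/-- `Sim` with an arbitrary lower bound. -/
def SimFrom (n : ℕ) (t : Tree) (c : ENNReal) {α : Type} (op : Gen α) (S : State) (a : α)
    (S' : State) : Prop :=
  c ≤ op.run S (a, S') * weight n S' t

section SimFrom

variable {n : ℕ} {t : Tree} {α β : Type} {c : ENNReal}

theorem SimFrom.bind {x : Gen α} {f : α → Gen β} {S S' S'' : State} {a : α} {b : β}
    {d : ENNReal} (hx : d ≤ x.run S (a, S')) (hf : SimFrom n t c (f a) S' b S'') :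
    SimFrom n t (d * c) (x >>= f) S b S'' := by
  unfold SimFrom at *
  calc d * c ≤ x.run S (a, S') * ((f a).run S' (b, S'') * weight n S'' t) := by gcongr
    _ = x.run S (a, S') * (f a).run S' (b, S'') * weight n S'' t := by rw [mul_assoc]
    _ ≤ _ := by
      gcongr
      exact le_run_bind x f S S' S'' a b

theorem SimFrom.choose_bind {p : PMF α} {f : α → Gen β} {S S' : State} (a : α) {b : β}
    (hf : SimFrom n t c (f a) S b S') : SimFrom n t (p a * c) (choose p >>= f) S b S' :=
  SimFrom.bind (run_choose p S a).ge hf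

theorem SimFrom.modify_bind {g : State → State} {f : PUnit → Gen β} {S S' : State} {b : β}
    (hf : SimFrom n t c (f PUnit.unit) (g S) b S') :
    SimFrom n t c (modify g >>= f) S b S' := by
  have := SimFrom.bind (run_modify g S).ge hf
  rwa [one_mul] at this

theorem SimFrom.set_bind {S₁ : State} {f : PUnit → Gen β} {S S' : State} {b : β}
    (hf : SimFrom n t c (f PUnit.unit) S₁ b S') :
    SimFrom n t c (set S₁ >>= f) S b S' := by
  have := SimFrom.bind (run_set S S₁).ge hf
  rwa [one_mul] at this

end SimFrom

/-! ### Correctness of the procedures -/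

section Correct

variable {n : ℕ} {t : Tree} {S : State}

theorem Inv.setPtr {e j i : ℕ} {f : Flag} (h : Inv n S e) (hj : S.ptr j = none) :
    Inv n (S.setPtr j i f) e := by
  refine ⟨h.pos, h.lt, fun i' f' hf hn => ?_, fun i' hi' => ?_, h.chain⟩
  · have h1 := h.u_front i' f' hf hn
    have hne : f' ≠ j := by
      rintro rfl
      simp [State.u, hj] at h1
    simpa [State.u, State.setPtr, Function.update_of_ne hne] using h1
  · by_cases hij : i' = j
    · simp [State.setPtr, hij]
    · simp only [State.setPtr, Function.update_of_ne hij]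
      exact h.ptr_ne i' hi'

theorem Frame.setPtr {j i : ℕ} {f : Flag} (hj : S.ptr j = none) : Frame S (S.setPtr j i f) := by
  refine ⟨⟨fun y p hp => ?_, fun j f hf => ⟨f, hf, le_rfl⟩⟩, rfl, rfl⟩
  have hne : y ≠ j := by
    rintro rfl
    simp [hj] at hp
  simpa [State.setPtr, Function.update_of_ne hne] using hp

/-- Φ depends only on the fronts, so fixing a pointer changes the factor of `j` alone, which becomes
1. -/
theorem weight_setPtr {j : ℕ} (h1 : 1 ≤ j) (hn : j ≤ n) :
    weight n S t = draw S j (t j) * weight n (S.setPtr j (t j).1 (t j).2) t := by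
  have hm : j ∈ Finset.Icc 1 n := Finset.mem_Icc.2 ⟨h1, hn⟩
  unfold weight
  rw [← Finset.mul_prod_erase _ _ hm, ← Finset.mul_prod_erase _ (fun j' => draw _ j' (t j')) hm,
    draw_eq_of_ptr (S := S.setPtr j (t j).1 (t j).2) (y := j) (by simp [State.setPtr]), one_mul]
  congr 1
  refine Finset.prod_congr rfl fun y hy => ?_
  have hy : y ≠ j := (Finset.mem_erase.1 hy).1
  rw [draw_congr (S := S) (S' := S.setPtr j (t j).1 (t j).2) (y := y)]
  · simp [State.setPtr, hy]
  · rfl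

theorem exists_sim_parent (hW : weight n S t ≠ 0) {e j : ℕ} (hI : Inv n S e) (hj1 : 1 ≤ j)
    (hjn : j ≤ n) :
    ∃ S', Sim n t (parent j) S (t j) S' ∧ Inv n S' e ∧ Frame S S' ∧ S'.front = S.front ∧
      S'.ptr j = some (t j) := by
  cases hp : S.ptr j with
  | some p =>
    have hpt := eq_of_ptr hW hj1 hjn hp
    subst hpt
    refine ⟨S, ?_, hI, Frame.refl S, rfl, hp⟩
    unfold parent
    refine Sim.get_bind ?_
    simp only [hp]
    exact Sim.pure _ _
  | none =>
    refine ⟨S.setPtr j (t j).1 (t j).2, ?_, hI.setPtr hp, Frame.setPtr hp, rfl, by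
      simp [State.setPtr]⟩
    unfold parent
    refine Sim.get_bind ?_
    simp only [hp]
    change SimFrom n t (weight n S t) _ _ _ _
    have hd := draw_ne_zero hW hj1 hjn
    rw [weight_setPtr hj1 hjn]
    by_cases hne : (S.Phi j).Nonempty
    · rw [dif_pos hne]
      rw [draw_of_nonempty hp hne] at hd ⊢
      have hmem : (t j).1 ∈ S.Phi j := by
        by_contra h
        simp [h] at hd
      rw [if_pos hmem, mul_assoc]
      have e1 : (S.phi j : ENNReal)⁻¹ = PMF.uniformOfFinset (S.Phi j) hne (t j).1 := by
        rw [PMF.uniformOfFinset_apply_of_mem hne hmem]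
        rfl
      -- Both factors of `draw` are rewritten as the probabilities of the two random choices of the
      -- program.
      rw [e1, ← uniformFlag_apply (t j).2]
      exact SimFrom.choose_bind (t j).1 (SimFrom.choose_bind (t j).2
        (SimFrom.set_bind (Sim.pure _ _)))
    · rw [dif_neg hne]
      rw [draw_of_empty hp hne] at hd ⊢
      have hjt : t j = (j, Flag.direct) := by
        by_contra h
        simp [h] at hd
      rw [hjt]
      simp only [PMF.pure_apply, if_true, one_mul]
      exact SimFrom.set_bind (Sim.pure _ _)

/-- Moving front(j) from `c` to `x` can change Φ(y) only for `c < y ≤ x`; there it just loses `j`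
(`Phi_setFront_erase`). -/
theorem Phi_setFront {S' : State} {j c x y : ℕ} (hc : c = (S.front j).getD j)
    (hjc : j ≤ c) (hcx : c < x) (hS' : S'.front = Function.update S.front j (some x))
    (hy : y ≤ c ∨ x < y) : S'.Phi y = S.Phi y := by
  ext i
  rw [State.mem_Phi, State.mem_Phi, hS']
  by_cases hij : i = j
  · subst hij
    simp only [Function.update_self, Option.some.injEq, forall_eq']
    cases hf : S.front i with
    | none =>
      simp only [hf, Option.getD_none] at hc
      simp
      omega
    | some f =>
      simp only [hf, Option.getD_some] at hc
      simp
      omega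
  · rw [Function.update_of_ne hij]

theorem Phi_setFront_erase {S' : State} {j x y : ℕ}
    (hS' : S'.front = Function.update S.front j (some x)) (hy : y ≤ x) :
    S'.Phi y = (S.Phi y).erase j := by
  ext i
  rw [Finset.mem_erase, State.mem_Phi, State.mem_Phi, hS']
  by_cases hij : i = j
  · subst hij
    simp
    omega
  · rw [Function.update_of_ne hij]
    simp [hij]

theorem mem_Phi_of_lt {j c y : ℕ} (hc : c = (S.front j).getD j) (hj1 : 1 ≤ j)
    (hjc : j ≤ c) (hcy : c < y) : j ∈ S.Phi y := by
  rw [State.mem_Phi]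
  refine ⟨⟨hj1, by omega⟩, fun f hf => ?_⟩
  simp [hf] at hc
  omega

open Classical in
-- The weights are compared vertex by vertex. At an undetermined `y` strictly between `c` and `x`
-- the draw rises from 1/φ(y) to 1/(φ(y)-1), which `searchFactor` compensates; at an undetermined
-- `x` pointer and flag are paid for; elsewhere nothing changes.
theorem weight_le_of_advance (hT : IsTree n t) (hW : weight n S t ≠ 0) {S' : State} {j c x : ℕ}
    (hc : c = (S.front j).getD j) (hj1 : 1 ≤ j) (hjc : j ≤ c) (hcx : c < x)
    (hx : Next n (fun y => c < y ∧ (t y).1 = j) x)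
    (hfront : S'.front = Function.update S.front j (some x))
    (hptr : ∀ y, y ≠ x → S'.ptr y = S.ptr y) (hptrx : x ≤ n → S'.ptr x = some (t x)) :
    weight n S t ≤ ((∏ y ∈ Finset.Ico (c + 1) x, searchFactor S y) *
      (if x ≤ n ∧ S.ptr x = none then (S.phi x : ENNReal)⁻¹ * 2⁻¹ else 1)) * weight n S' t := by
  have hxn := hx.le
  have e1 : (∏ y ∈ Finset.Ico (c + 1) x, searchFactor S y) =
      ∏ y ∈ Finset.Icc 1 n, if y ∈ Finset.Ico (c + 1) x then searchFactor S y else 1 := by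
    rw [Finset.prod_ite_mem]
    congr 1
    ext y
    simp
    omega
  have e2 : (if x ≤ n ∧ S.ptr x = none then (S.phi x : ENNReal)⁻¹ * 2⁻¹ else 1) =
      ∏ y ∈ Finset.Icc 1 n, if x = y then
        (if S.ptr y = none then (S.phi y : ENNReal)⁻¹ * 2⁻¹ else 1) else 1 := by
    rw [Finset.prod_ite_eq]
    by_cases h : x ≤ n
    · simp [h]
      intro h0
      omega
    · simp [h]
  unfold weight
  rw [e1, e2, ← Finset.prod_mul_distrib, ← Finset.prod_mul_distrib]
  refine Finset.prod_le_prod' fun y hy => ?_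
  rw [Finset.mem_Icc] at hy
  by_cases hyx : y = x
  · subst hyx
    rw [if_neg (by simp), if_pos rfl, one_mul, draw_eq_of_ptr (hptrx hy.2), mul_one]
    split_ifs with hp
    · rw [draw_of_nonempty hp ⟨j, mem_Phi_of_lt hc hj1 hjc hcx⟩]
      split_ifs <;> simp
    · exact PMF.coe_le_one _ _
  · rw [if_neg (Ne.symm hyx), mul_one]
    by_cases hyI : y ∈ Finset.Ico (c + 1) x
    · rw [if_pos hyI]
      rw [Finset.mem_Ico] at hyI
      have hPhi := Phi_setFront_erase hfront (y := y) (by omega)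
      cases hp : S.ptr y with
      | some p =>
        rw [searchFactor, if_neg (by simp [hp]), one_mul, draw_of_ptr hp,
          draw_of_ptr ((hptr y hyx).trans hp)]
      | none =>
        rw [searchFactor, if_pos hp]
        have hjm := mem_Phi_of_lt hc hj1 hjc (y := y) (by omega)
        have htm := mem_Phi_of_ptr hT hW (by omega) hy.2 hp
        have hne : (t y).1 ≠ j := fun h => by
          have := hx.min y hy.2 ⟨by omega, h⟩
          omega
        have htm' : (t y).1 ∈ S'.Phi y := by
          rw [hPhi, Finset.mem_erase]
          exact ⟨hne, htm⟩
        have hphi : S'.phi y = S.phi y - 1 := by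
          unfold State.phi
          rw [hPhi, Finset.card_erase_of_mem hjm]
        -- The pointer prescribed by `t` differs from `j`, since `x` is the next child of `j`, and
        -- so survives the removal of `j`.
        have hpos : S.phi y - 1 ≠ 0 := by
          rw [← hphi]
          exact (Finset.card_pos.2 ⟨_, htm'⟩).ne'
        rw [draw_of_nonempty hp ⟨j, hjm⟩, draw_of_nonempty ((hptr y hyx).trans hp) ⟨_, htm'⟩,
          if_pos htm, if_pos htm', hphi, div_eq_mul_inv,
          mul_comm ((S.phi y - 1 : ℕ) : ENNReal), mul_assoc, ← mul_assoc ((S.phi y - 1 : ℕ) : ENNReal),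
          ENNReal.mul_inv_cancel (by exact_mod_cast hpos) (by simp), one_mul]
    · rw [if_neg hyI, one_mul, draw_congr (hptr y hyx)]
      refine Phi_setFront hc hjc hcx hfront ?_
      rw [Finset.mem_Ico] at hyI
      omega

end Correct

/-! ### The procedure next-child -/

section Correct

variable {n : ℕ} {t : Tree} {S : State}

/-- The exceptional vertex passes from `j`, which now has a front, to its new front `x`, which may
have none until the recursive call. -/
theorem Inv.advance {S' : State} {j c x : ℕ} (h : Inv n S j) (hc : c = (S.front j).getD j)
    (hj1 : 1 ≤ j) (hjc : j ≤ c) (hcx : c < x) (hpj : S.ptr j ≠ none)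
    (hfront : S'.front = Function.update S.front j (some x))
    (hptr : ∀ y p, S.ptr y = some p → S'.ptr y = some p) (hptrx : x ≤ n → S'.u x = some j) :
    Inv n S' x := by
  have hu : ∀ y i, S.u y = some i → S'.u y = some i := by
    intro y i hy
    obtain ⟨p, hp, hpi⟩ := Option.map_eq_some_iff.1 hy
    simp [State.u, hptr y p hp, hpi]
  have hptr' : ∀ y, S.ptr y ≠ none → S'.ptr y ≠ none := by
    intro y hy
    obtain ⟨p, hp⟩ := Option.ne_none_iff_exists'.1 hy
    simp [hptr y p hp]
  have hfr : ∀ i f, S'.front i = some f → (i = j ∧ f = x) ∨ S.front i = some f := by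
    intro i f hf
    rw [hfront] at hf
    by_cases hij : i = j
    · subst hij
      left
      simpa [eq_comm] using hf
    · rw [Function.update_of_ne hij] at hf
      exact Or.inr hf
  refine ⟨fun i f hf => ?_, fun i f hf => ?_, fun i f hf hn => ?_, fun i hi => ?_,
    fun i f hf hn hfx => ?_⟩
  · rcases hfr i f hf with ⟨rfl, rfl⟩ | hf
    · exact hj1
    · exact h.pos i f hf
  · rcases hfr i f hf with ⟨rfl, rfl⟩ | hf
    · omega
    · exact h.lt i f hf
  · rcases hfr i f hf with ⟨rfl, rfl⟩ | hf
    · exact hptrx hn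
    · exact hu _ _ (h.u_front i f hf hn)
  · obtain ⟨f, hf⟩ := Option.ne_none_iff_exists'.1 hi
    rcases hfr i f hf with ⟨rfl, rfl⟩ | hf
    · exact hptr' _ hpj
    · exact hptr' _ (h.ptr_ne i (by simp [hf]))
  · rw [hfront]
    by_cases hfj : f = j
    · simp [hfj]
    · rw [Function.update_of_ne hfj]
      rcases hfr i f hf with ⟨rfl, rfl⟩ | hf
      · exact absurd rfl hfx
      · exact h.chain i f hf hn hfj

theorem Frame.advance {S' : State} {j c x : ℕ} (hc : c = (S.front j).getD j) (hcx : c < x)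
    (hfront : S'.front = Function.update S.front j (some x))
    (hptr : ∀ y p, S.ptr y = some p → S'.ptr y = some p) (hheap : S'.heap = S.heap)
    (hfq : S'.firstQuery = S.firstQuery) : Frame S S' := by
  refine ⟨⟨hptr, fun i f hf => ?_⟩, hheap, hfq⟩
  rw [hfront]
  by_cases hij : i = j
  · subst hij
    simp only [hf, Option.getD_some] at hc
    exact ⟨x, by simp, by omega⟩
  · exact ⟨f, by rw [Function.update_of_ne hij, hf], le_rfl⟩

/-- Along the tree `t`, the program may go from a good state `S` to a good state `S'`. -/
structure Step (n : ℕ) (t : Tree) {α : Type} (op : Gen α) (S : State) (a : α) (S' : State) :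
    Prop where
  sim : Sim n t op S a S'
  inv : Inv n S' 0
  frame : Frame S S'

/-- The invariant is assumed with exception `j`, because the recursive call starts on a vertex that
is already a front but has none. The call removes the exception, which makes the induction on `n -
j` close. -/
theorem exists_step_nextChild (hT : IsTree n t) (j : ℕ) (S : State) (hW : weight n S t ≠ 0)
    (hI : Inv n S j) (hj1 : 1 ≤ j) (hjn : j ≤ n) :
    ∃ x S', Step n t (nextChild n j) S x S' ∧ (∀ f, S.front j = some f → n ≤ f → x = n + 1) ∧
      (¬ (S.front j).any (fun f => n ≤ f) → Next n (fun y => (S.front j).getD j < y ∧ (t y).1 = j) x ∧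
        ∃ f, S'.front j = some f ∧ x ≤ f) := by
  induction hd : n - j using Nat.strong_induction_on generalizing j S with
  | _ d ih =>
  obtain ⟨S₁, hsim₁, hI₁, hF₁, hf₁, hp₁⟩ := exists_sim_parent hW hI hj1 hjn
  have hW₁ := hsim₁.weight_ne_zero hW
  by_cases hcond : (S.front j).any (fun f => n ≤ f)
  · have hne : S.front j ≠ none := by
      rintro h
      simp [h] at hcond
    refine ⟨n + 1, S₁, ⟨?_, hI₁.strengthen (by rwa [hf₁]), hF₁⟩, fun _ _ _ => rfl,
      fun h => absurd hcond h⟩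
    rw [nextChild]
    refine hsim₁.bind (Sim.get_bind ?_)
    rw [hf₁, if_pos hcond]
    exact Sim.pure _ _
  · obtain ⟨c, hc⟩ : ∃ c, c = (S.front j).getD j := ⟨_, rfl⟩
    have hjc : j ≤ c := by
      rw [hc]
      cases hf : S.front j with
      | none => simp
      | some f => simpa using (hI.lt j f hf).le
    obtain ⟨x, hx⟩ := exists_next n (fun y => c < y ∧ (t y).1 = j)
    have hcn : c ≤ n := by
      rw [hc]
      cases hf : S.front j with
      | none => simpa
      | some f =>
        simp [hf] at hcond
        simp
        omega
    have hcx : c < x := by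
      by_cases hxn : x ≤ n
      · exact (hx.prop hxn).1
      · omega
    have hxn := hx.le
    have hb := next_succChild (n := n) S₁ j c
    obtain ⟨b, hbdef⟩ : ∃ b, b = S₁.succChild n j c := ⟨_, rfl⟩
    rw [← hbdef] at hb
    have hbn := hb.le
    have hxb : x ≤ b := by
      by_cases hbn' : b ≤ n
      · obtain ⟨h1, h2, h3⟩ := hb.prop hbn'
        exact hx.min b hbn' ⟨h1, ((u_eq_iff hW₁ (by omega) hbn').1 h3).2⟩
      · omega
    -- The true next child `x` precedes the next known child `b` exactly when the search has to
    -- discover it.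
    have hxb_iff : x < b ↔ x ≤ n ∧ S₁.ptr x = none := by
      constructor
      · intro h
        refine ⟨by omega, ?_⟩
        by_contra hp
        obtain ⟨p, hp⟩ := Option.ne_none_iff_exists'.1 hp
        have htp := eq_of_ptr hW₁ (by omega) (by omega) hp
        have := hb.min x (by omega) ⟨hcx, by omega,
          (u_eq_iff hW₁ (by omega) (by omega)).2 ⟨by rw [hp, htp], (hx.prop (by omega)).2⟩⟩
        omega
      · rintro ⟨h1, h2⟩
        refine lt_of_le_of_ne hxb fun h => ?_
        subst h
        have := (hb.prop h1).2.2
        simp [State.u, h2] at this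
    have hc₁ : c = (S₁.front j).getD j := by rw [hf₁, hc]
    have hsearch := le_search (b := b) (x := x) hI₁ hbn
      (by rcases hxb.eq_or_lt with h | h
          · exact Or.inl h
          · exact Or.inr ⟨h, (hxb_iff.1 h).2⟩) (c + 1) (by omega) (by omega)
      (fun y hy _ => Finset.card_pos.2 ⟨j, mem_Phi_of_lt hc₁ hj1 hjc (by omega)⟩)
    -- the memory after the search
    classical
    obtain ⟨S₂, hS₂⟩ : ∃ S₂ : State, S₂ = if x ≠ b then S₁.setPtr x j (t x).2 else S₁ := ⟨_, rfl⟩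
    have hptr₂ : ∀ y, y ≠ x → S₂.ptr y = S₁.ptr y := by
      intro y hy
      rw [hS₂]
      split_ifs <;> simp [State.setPtr, hy]
    have hptr₂x : x ≤ n → S₂.ptr x = some (t x) := by
      intro hxn'
      rw [hS₂]
      split_ifs with h
      · simp only [State.setPtr, Function.update_self]
        rw [← (hx.prop hxn').2]
      · have h : x = b := not_not.1 h
        subst h
        exact ((u_eq_iff hW₁ (by omega) hxn').1 (hb.prop hxn').2.2).1
    have hptr₂' : ∀ y p, S₁.ptr y = some p → S₂.ptr y = some p := by
      intro y p hp
      by_cases hy : y = x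
      · subst hy
        rw [hS₂]
        split_ifs with h
        · have := (hxb_iff.1 (lt_of_le_of_ne hxb h)).2
          simp [this] at hp
        · exact hp
      · rw [hptr₂ y hy, hp]
    have hfront₂ : S₂.front = S₁.front := by rw [hS₂]; split_ifs <;> rfl
    have hheap₂ : S₂.heap = S₁.heap := by rw [hS₂]; split_ifs <;> rfl
    have hfq₂ : S₂.firstQuery = S₁.firstQuery := by rw [hS₂]; split_ifs <;> rfl
    have hfront₃ : (S₂.setFront j x).front = Function.update S₁.front j (some x) := by
      simp only [State.setFront, hfront₂]
    have hI₃ : Inv n (S₂.setFront j x) x := hI₁.advance hc₁ hj1 hjc hcx (by simp [hp₁]) hfront₃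
      hptr₂' (fun h => by simp only [State.u, State.setFront, hptr₂x h]; simp [(hx.prop h).2])
    have hF₃ : Frame S₁ (S₂.setFront j x) := Frame.advance hc₁ hcx hfront₃ hptr₂' hheap₂ hfq₂
    have hweight := weight_le_of_advance hT hW₁ hc₁ hj1 hjc hcx hx hfront₃ hptr₂ hptr₂x
    have hW₃ : weight n (S₂.setFront j x) t ≠ 0 := by
      intro h
      rw [h, mul_zero] at hweight
      exact hW₁ (by simpa using hweight)
    -- the recursive call
    have hrec : ∃ S₄, Sim n t (do
        let S ← get
        if _h : j < x ∧ x ≤ n ∧ S.front x = none then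
          let _ ← nextChild n x
          return x
        else
          return x) (S₂.setFront j x) x S₄ ∧ Inv n S₄ 0 ∧ Frame (S₂.setFront j x) S₄ := by
      by_cases h : j < x ∧ x ≤ n ∧ (S₂.setFront j x).front x = none
      · obtain ⟨y, S₄, hstep, -⟩ := ih (n - x) (by omega) x (S₂.setFront j x) hW₃ hI₃ (by omega)
          (by omega) rfl
        refine ⟨S₄, Sim.get_bind ?_, hstep.inv, hstep.frame⟩
        rw [dif_pos h]
        exact hstep.sim.bind (Sim.pure _ _)
      · refine ⟨S₂.setFront j x, Sim.get_bind ?_, ?_, Frame.refl _⟩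
        · rw [dif_neg h]
          exact Sim.pure _ _
        · by_cases hxn' : x ≤ n
          · exact hI₃.strengthen fun h' => h ⟨by omega, hxn', h'⟩
          -- Here `x = n + 1`, so the exception is void: `chain` concerns only fronts at most `n`.
          · exact ⟨hI₃.pos, hI₃.lt, hI₃.u_front, hI₃.ptr_ne, fun i f hf hn _ =>
              hI₃.chain i f hf hn (by omega)⟩
    obtain ⟨S₄, hsim₄, hI₄, hF₄⟩ := hrec
    refine ⟨x, S₄, ⟨?_, hI₄, hF₁.trans (hF₃.trans hF₄)⟩, fun f hf hnf => ?_, fun _ => ⟨hc ▸ hx, ?_⟩⟩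
    · rw [nextChild]
      refine hsim₁.bind (Sim.get_bind ?_)
      rw [hf₁, if_neg hcond, ← hc]
      dsimp only
      rw [← hbdef]
      by_cases hxb' : x = b
      · have hne : ¬ (x ≤ n ∧ S₁.ptr x = none) := fun h => by
          have := hxb_iff.2 h
          omega
        rw [if_neg hne, mul_one] at hweight
        rw [if_neg (by omega), mul_one] at hsearch
        have hS : S₂ = S₁ := by rw [hS₂, if_neg (by simpa using hxb')]
        refine (hweight.trans (mul_le_mul_left hsearch _)).trans (SimFrom.choose_bind x ?_)
        rw [if_neg (by simpa using hxb')]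
        refine SimFrom.modify_bind ?_
        rw [hS] at hsim₄ ⊢
        exact hsim₄
      · have hlt := lt_of_le_of_ne hxb hxb'
        rw [if_pos (hxb_iff.1 hlt), ← mul_assoc] at hweight
        rw [if_pos hlt] at hsearch
        have hS : S₂ = S₁.setPtr x j (t x).2 := by rw [hS₂, if_pos hxb']
        rw [← uniformFlag_apply (t x).2, mul_assoc] at hweight
        refine (hweight.trans (mul_le_mul_left hsearch _)).trans (SimFrom.choose_bind x ?_)
        rw [if_pos hxb']
        refine SimFrom.choose_bind (t x).2 (SimFrom.modify_bind (SimFrom.modify_bind ?_))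
        rw [hS] at hsim₄ ⊢
        exact hsim₄
    · simp [hf] at hcond
      omega
    · obtain ⟨f, hf, hle⟩ := hF₄.front j x (by simp [State.setFront])
      exact ⟨f, hf, hle⟩

end Correct

/-! ### The procedures next-child-from and next-child-tp -/

section Correct

variable {n : ℕ} {t : Tree} {S : State}

/-- The search for the children of the pointer of `x` has reached `x`. -/
def Known (S : State) (t : Tree) (x : ℕ) : Prop :=
  ∃ f, S.front (t x).1 = some f ∧ x ≤ f

theorem Known.mono {S' : State} {x : ℕ} (h : Known S t x) (hS : Ext S S') : Known S' t x := by
  obtain ⟨f, hf, hle⟩ := h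
  obtain ⟨f', hf', hle'⟩ := hS.front _ f hf
  exact ⟨f', hf', hle.trans hle'⟩

theorem Known.ptr {x : ℕ} (h : Known S t x) (hT : IsTree n t) (hW : weight n S t ≠ 0)
    (hx2 : 2 ≤ x) (hxn : x ≤ n) : S.ptr x = some (t x) := by
  obtain ⟨f, hf, hle⟩ := h
  exact ptr_of_le_front hT hW hx2 hxn hf hle

/-- The procedure next-child searches beyond front(j), not beyond `k`. By `hk` a defined front is
not behind `k`, and all children up to it are known, so when none of them lies beyond `k` both
searches have the same answer. -/
theorem exists_step_nextChildFrom (hT : IsTree n t) (hW : weight n S t ≠ 0) (hI : Inv n S 0)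
    {j k : ℕ} (hj1 : 1 ≤ j) (hjn : j ≤ n) (hjk : j ≤ k)
    (hk : k = j ∨ ∃ f, S.front j = some f ∧ k ≤ f) :
    ∃ x S', Step n t (nextChildFrom n j k) S x S' ∧ Next n (fun y => k < y ∧ (t y).1 = j) x ∧
      (x ≤ n → Known S' t x) := by
  unfold nextChildFrom
  by_cases hnk : n ≤ k
  · rw [if_pos hnk]
    exact ⟨n + 1, S, ⟨Sim.pure _ _, hI, Frame.refl S⟩,
      ⟨le_rfl, fun h => by omega, fun y hy hy' => by omega⟩, fun h => by omega⟩
  rw [if_neg hnk]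
  have hq := next_succChild (n := n) S j k
  -- the children of `j` that are at most `front(j)` are known
  have hfront : ∀ f, S.front j = some f → ∀ y ≤ n, k < y → (t y).1 = j → y ≤ f →
      S.succChild n j k ≤ y := by
    intro f hf y hyn hky hyj hyf
    have hp := ptr_of_le_front hT hW (by omega) hyn (by rw [hyj, hf]) hyf
    exact hq.min y hyn ⟨hky, by omega, (u_eq_iff hW (by omega) hyn).2 ⟨hp, hyj⟩⟩
  by_cases hcond : (S.front j).any (fun f => S.succChild n j k ≤ f)
  · obtain ⟨f, hf, hle⟩ : ∃ f, S.front j = some f ∧ S.succChild n j k ≤ f := by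
      simpa using (Option.any_eq_true_iff_get _ _).1 hcond |> fun ⟨h, h'⟩ =>
        ⟨_, (Option.some_get h).symm, by simpa using h'⟩
    have hprop : S.succChild n j k ≤ n → k < S.succChild n j k ∧ (t (S.succChild n j k)).1 = j := by
      intro h
      obtain ⟨h1, h2, h3⟩ := hq.prop h
      exact ⟨h1, ((u_eq_iff hW (by omega) h).1 h3).2⟩
    refine ⟨S.succChild n j k, S, ⟨Sim.get_bind ?_, hI, Frame.refl S⟩,
      ⟨hq.le, hprop, fun y hy hy' => ?_⟩, fun h => ⟨f, by rw [(hprop h).2, hf], hle⟩⟩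
    · rw [if_pos hcond]
      exact Sim.pure _ _
    · by_contra hlt
      exact hlt (hfront f hf y hy hy'.1 hy'.2 (by omega))
  · obtain ⟨x, S', hstep, h1, h2⟩ := exists_step_nextChild hT j S hW hI.weaken hj1 hjn
    refine ⟨x, S', ⟨Sim.get_bind ?_, hstep.inv, hstep.frame⟩, ?_⟩
    · rw [if_neg hcond]
      exact hstep.sim
    · cases hf : S.front j with
      | none =>
        have hkj : k = j := by simpa [hf] using hk
        subst hkj
        simp only [hf, Option.any_none, Option.getD_none, Bool.false_eq_true, not_false_eq_true,
          forall_const] at h2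
        obtain ⟨h2, f, hf', hle⟩ := h2
        exact ⟨h2, fun hxn => ⟨f, by rw [(h2.prop hxn).2, hf'], hle⟩⟩
      | some f =>
        have hfj := hI.lt j f hf
        have hkf : k ≤ f := by
          rcases hk with rfl | ⟨f', hf', hle⟩
          · exact hfj.le
          · rw [hf] at hf'
            simp at hf'
            omega
        simp only [hf, Option.any_some, decide_eq_true_eq, not_le] at hcond
        have hmin : ∀ y ≤ n, k < y → (t y).1 = j → f < y := by
          intro y hyn hky hyj
          by_contra hlt
          have := hfront f hf y hyn hky hyj (by omega)
          omega
        by_cases hnf : n ≤ f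
        · have := h1 f hf hnf
          subst this
          exact ⟨⟨le_rfl, fun h => by omega, fun y hy hy' => by
            have := hmin y hy hy'.1 hy'.2
            omega⟩, fun h => by omega⟩
        · simp only [hf, Option.any_some, decide_eq_true_eq, Option.getD_some] at h2
          obtain ⟨h2, f', hf', hle⟩ := h2 hnf
          exact ⟨h2.congr fun y hy => ⟨fun h => ⟨by omega, h.2⟩, fun h => ⟨hmin y hy h.1 h.2, h.2⟩⟩,
            fun hxn => ⟨f', by rw [(h2.prop hxn).2, hf'], hle⟩⟩

theorem exists_step_nextChildTp (hT : IsTree n t) {j : ℕ} (τ : Flag) (hj1 : 1 ≤ j) (hjn : j ≤ n)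
    (k : ℕ) (S : State) (hW : weight n S t ≠ 0) (hI : Inv n S 0) (hjk : j ≤ k)
    (hk : k = j ∨ ∃ f, S.front j = some f ∧ k ≤ f) :
    ∃ x S', Step n t (nextChildTp n j k τ) S x S' ∧ Next n (fun y => k < y ∧ t y = (j, τ)) x ∧
      (x ≤ n → Known S' t x) := by
  induction hd : n - k using Nat.strong_induction_on generalizing k S with
  | _ d ih =>
  obtain ⟨x, S', hstep, hx, hK⟩ := exists_step_nextChildFrom hT hW hI hj1 hjn hjk hk
  have hW' := hstep.sim.weight_ne_zero hW
  have hflag : x ≤ n → S'.flag x = some (t x).2 := fun hxn => by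
    have := (hK hxn).ptr hT hW' (by have := (hx.prop hxn).1; omega) hxn
    simp [State.flag, this]
  by_cases hcond : k < x ∧ x ≤ n ∧ S'.flag x ≠ some τ
  · obtain ⟨hkx, hxn, hne⟩ := id hcond
    obtain ⟨f, hf, hle⟩ := hK hxn
    rw [(hx.prop hxn).2] at hf
    obtain ⟨x', S'', hstep', hx', hK'⟩ := ih (n - x) (by omega) x S' hW' hstep.inv (by omega)
      (Or.inr ⟨f, hf, hle⟩) rfl
    refine ⟨x', S'', ⟨?_, hstep'.inv, hstep.frame.trans hstep'.frame⟩,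
      hx'.congr fun y hy => ⟨fun h => ⟨by omega, h.2⟩, fun h => ⟨?_, h.2⟩⟩, hK'⟩
    · rw [nextChildTp]
      refine hstep.sim.bind (Sim.get_bind ?_)
      rw [dif_pos hcond]
      exact hstep'.sim
    · have h1 := hx.min y hy ⟨h.1, by rw [h.2]⟩
      refine lt_of_le_of_ne h1 ?_
      rintro rfl
      rw [hflag hxn, h.2] at hne
      exact hne rfl
  · refine ⟨x, S', ⟨?_, hstep.inv, hstep.frame⟩, ⟨hx.le, fun hxn => ?_, fun y hy h => ?_⟩, hK⟩
    · rw [nextChildTp]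
      refine hstep.sim.bind (Sim.get_bind ?_)
      rw [dif_neg hcond]
      exact Sim.pure _ _
    · have hp := hx.prop hxn
      have : S'.flag x = some τ := by
        by_contra h
        exact hcond ⟨hp.1, hxn, h⟩
      rw [hflag hxn] at this
      exact ⟨hp.1, Prod.ext hp.2 (by simpa using this)⟩
    · exact hx.min y hy ⟨h.1, by rw [h.2]⟩

end Correct

/-! ### The Barabási–Albert graph of a pointers tree -/

/-- The head of the edge out of `j` in the graph of the tree `t`. -/
def treeParent (t : Tree) (j : ℕ) : ℕ :=
  if _h : (t j).1 < j ∧ (t j).2 = Flag.recursive then treeParent t (t j).1 else (t j).1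
termination_by j
decreasing_by exact _h.1

section TreeParent

variable {n : ℕ} {t : Tree}

theorem treeParent_of_direct {j : ℕ} (h : (t j).2 = Flag.direct) : treeParent t j = (t j).1 := by
  rw [treeParent, dif_neg]
  rintro ⟨-, h'⟩
  rw [h] at h'
  cases h'

theorem treeParent_of_recursive {j : ℕ} (hlt : (t j).1 < j) (h : (t j).2 = Flag.recursive) :
    treeParent t j = treeParent t (t j).1 := by
  rw [treeParent, dif_pos ⟨hlt, h⟩]

theorem treeParent_one (hT : IsTree n t) : treeParent t 1 = 1 := by
  rw [treeParent_of_direct (by rw [hT.root]), hT.root]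

theorem treeParent_mem (hT : IsTree n t) (j : ℕ) (hj2 : 2 ≤ j) (hjn : j ≤ n) :
    1 ≤ treeParent t j ∧ treeParent t j < j := by
  induction j using Nat.strong_induction_on with
  | _ j ih =>
  have h1 := hT.pos j hj2 hjn
  have h2 := hT.lt j hj2 hjn
  cases hf : (t j).2 with
  | direct => rw [treeParent_of_direct hf]; exact ⟨h1, h2⟩
  | recursive =>
    rw [treeParent_of_recursive h2 hf]
    by_cases h : (t j).1 = 1
    · rw [h, treeParent_one hT]
      omega
    · have := ih _ h2 (by omega) (by omega)
      omega

theorem treeParent_congr (hT : IsTree n t) {x y : ℕ} (hx2 : 2 ≤ x) (hxn : x ≤ n) (hy2 : 2 ≤ y)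
    (hyn : y ≤ n) (h : t x = t y) : treeParent t x = treeParent t y := by
  have h1 := hT.lt x hx2 hxn
  have h2 := hT.lt y hy2 hyn
  cases hf : (t y).2 with
  | direct => rw [treeParent_of_direct hf, treeParent_of_direct (by rw [h, hf]), h]
  | recursive =>
    rw [treeParent_of_recursive h2 hf, treeParent_of_recursive h1 (by rw [h, hf]), h]

theorem exists_step_baParent (hT : IsTree n t) (j : ℕ) (S : State) (hW : weight n S t ≠ 0)
    (hI : Inv n S 0) (hj1 : 1 ≤ j) (hjn : j ≤ n) :
    ∃ S', Step n t (baParent j) S (treeParent t j) S' := by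
  induction j using Nat.strong_induction_on generalizing S with
  | _ j ih =>
  obtain ⟨S₁, hsim₁, hI₁, hF₁, -, -⟩ := exists_sim_parent hW hI hj1 hjn
  by_cases hcond : (t j).1 < j ∧ (t j).2 = Flag.recursive
  · have hj2 : 2 ≤ j := by
      by_contra h
      obtain rfl : j = 1 := by omega
      simp [hT.root] at hcond
    obtain ⟨S₂, h₂⟩ := ih (t j).1 hcond.1 S₁ (hsim₁.weight_ne_zero hW) hI₁ (hT.pos j hj2 hjn)
      (by omega)
    refine ⟨S₂, ⟨?_, h₂.inv, hF₁.trans h₂.frame⟩⟩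
    rw [baParent, treeParent, dif_pos hcond]
    refine hsim₁.bind ?_
    rw [dif_pos hcond]
    exact h₂.sim
  · refine ⟨S₁, ⟨?_, hI₁, hF₁⟩⟩
    rw [baParent, treeParent, dif_neg hcond]
    refine hsim₁.bind ?_
    rw [dif_neg hcond]
    exact Sim.pure _ _

end TreeParent

/-! ### The heaps -/

/-- `x` is a child of `j` in the graph beyond `L`, and it is the first vertex beyond `L` with its
pointer and flag, where the pointer is at most `L`. -/
structure Frontier (t : Tree) (j L x : ℕ) : Prop where
  lt : L < x
  parent : treeParent t x = j
  le : (t x).1 ≤ L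
  first : ∀ y, L < y → y < x → t y ≠ t x

/-- `x` is the least child of `j` in the graph beyond `L`. -/
abbrev NextInGraph (n : ℕ) (t : Tree) (j L x : ℕ) : Prop :=
  Next n (fun y => L < y ∧ treeParent t y = j) x

section Frontier

variable {n : ℕ} {t : Tree} {j L : ℕ}

theorem fst_eq_or_recursive (hT : IsTree n t) {x : ℕ} (hx2 : 2 ≤ x) (hxn : x ≤ n)
    (hx : treeParent t x = j) :
    (t x).1 = j ∨ (t x).2 = Flag.recursive ∧ treeParent t (t x).1 = j := by
  cases hf : (t x).2 with
  | direct => rw [treeParent_of_direct hf] at hx; exact Or.inl hx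
  | recursive =>
    rw [treeParent_of_recursive (hT.lt x hx2 hxn) hf] at hx
    exact Or.inr ⟨rfl, hx⟩

/-- A recursive pointer of `r` leads to a smaller vertex; if that is not `j` itself, it is a child
of `j`, so by minimality of `r` it cannot exceed `L`. -/
theorem NextInGraph.frontier (hT : IsTree n t) (hj1 : 1 ≤ j) (hjL : j ≤ L) {r : ℕ}
    (hr : NextInGraph n t j L r) (hrn : r ≤ n) : Frontier t j L r := by
  obtain ⟨h1, h2⟩ := hr.prop hrn
  refine ⟨h1, h2, ?_, fun y hy hyr hty => ?_⟩
  · rcases fst_eq_or_recursive hT (by omega) hrn h2 with h | ⟨-, h⟩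
    · omega
    · have h3 := hT.lt r (by omega) hrn
      by_contra hlt
      have := hr.min _ (by omega) ⟨not_le.1 hlt, h⟩
      omega
  · have := hr.min y (by omega)
      ⟨hy, by rw [treeParent_congr hT (by omega) (by omega) (by omega) hrn hty, h2]⟩
    omega

/-- No child of `j` lies strictly between `L` and `r`. Advancing `L` to `r` therefore removes `r`
and adds only its successor `x₁` with the same pointer and flag, and the first recursive child `x₂`
of `r`. Disjointness of the cases keeps multiplicities in the heap at one. -/
theorem frontier_iff (hT : IsTree n t) (hj1 : 1 ≤ j) (hjL : j ≤ L) {r x₁ x₂ : ℕ} (hrn : r ≤ n)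
    (hr : NextInGraph n t j L r) (h₁ : Next n (fun y => r < y ∧ t y = t r) x₁)
    (h₂ : Next n (fun y => r < y ∧ t y = (r, Flag.recursive)) x₂) {x : ℕ} (hxn : x ≤ n) :
    (x = r → Frontier t j L x ∧ ¬ Frontier t j r x ∧ x ≠ x₁ ∧ x ≠ x₂) ∧
    (x = x₁ → ¬ Frontier t j L x ∧ Frontier t j r x ∧ x ≠ x₂) ∧
    (x = x₂ → ¬ Frontier t j L x ∧ Frontier t j r x) ∧
    (x ≠ r → x ≠ x₁ → x ≠ x₂ → (Frontier t j r x ↔ Frontier t j L x)) := by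
  obtain ⟨hLr, hrj⟩ := hr.prop hrn
  have hrt := hT.lt r (by omega) hrn
  have hx₁p := h₁.prop
  have hx₂p := h₂.prop
  refine ⟨?_, ?_, ?_, ?_⟩
  · rintro rfl
    refine ⟨hr.frontier hT hj1 hjL hrn, fun h => lt_irrefl _ h.lt, ?_, ?_⟩
    · rintro h
      have := (hx₁p (by omega)).1
      omega
    · rintro h
      have := (hx₂p (by omega)).1
      omega
  · rintro rfl
    obtain ⟨h3, h4⟩ := hx₁p hxn
    refine ⟨fun h => h.first r hLr h3 h4.symm, ⟨h3, ?_, by rw [h4]; omega, fun y hy hyx hty => ?_⟩, ?_⟩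
    · rw [treeParent_congr hT (by omega) hxn (by omega) hrn h4, hrj]
    · have := h₁.min y (by omega) ⟨hy, hty.trans h4⟩
      omega
    · rintro rfl
      have := (hx₂p hxn).2
      rw [h4] at this
      rw [this] at hrt
      exact absurd hrt (lt_irrefl _)
  · rintro rfl
    obtain ⟨h3, h4⟩ := hx₂p hxn
    refine ⟨fun h => ?_, ⟨h3, ?_, by rw [h4], fun y hy hyx hty => ?_⟩⟩
    · have := h.le
      rw [h4] at this
      simp at this
      omega
    · rw [treeParent_of_recursive (by rw [h4]; exact h3) (by rw [h4]), h4, hrj]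
    · have := h₂.min y (by omega) ⟨hy, hty.trans h4⟩
      omega
  · intro hxr hx₁ hx₂
    constructor
    · intro h
      have hrx := h.lt
      refine ⟨by omega, h.parent, ?_, fun y hy hyx hty => ?_⟩
      · rcases fst_eq_or_recursive hT (by omega) hxn h.parent with h5 | ⟨h5, h6⟩
        · omega
        · by_contra hlt
          have h7 := hr.min (t x).1 (by have := h.le; omega) ⟨not_le.1 hlt, h6⟩
          -- A pointer beyond `L` must be `r` itself, and then the first vertex with it is `x₂`,
          -- contrary to `x ≠ x₂`.
          have h8 : t x = (r, Flag.recursive) := Prod.ext (le_antisymm h.le h7) h5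
          have h9 := h₂.min x hxn ⟨hrx, h8⟩
          exact h.first x₂ (hx₂p (by omega)).1 (by omega) ((hx₂p (by omega)).2.trans h8.symm)
      · rcases lt_trichotomy y r with hyr | rfl | hyr
        · have := hr.min y (by omega)
            ⟨hy, by rw [treeParent_congr hT (by omega) (by omega) (by omega) hxn hty, h.parent]⟩
          omega
        · have h9 := h₁.min x hxn ⟨hrx, hty.symm⟩
          exact h.first x₁ (hx₁p (by omega)).1 (by omega) ((hx₁p (by omega)).2.trans hty)
        · exact h.first y hyr hyx hty
    · intro h
      have h5 := hr.min x hxn ⟨h.lt, h.parent⟩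
      exact ⟨by omega, h.parent, by have := h.le; omega, fun y hy hyx => h.first y (by omega) hyx⟩

end Frontier

open Classical in
/-- The list `h` is correct as heap of `j` when `L` is the last child of `j` in the graph that was
returned. -/
structure HeapCorrect (n : ℕ) (t : Tree) (S : State) (j L : ℕ) (h : List ℕ) : Prop where
  sorted : h.Pairwise (· ≤ ·)
  top : n + 1 ∈ h
  count : ∀ x ≤ n, h.count x = if Frontier t j L x then 1 else 0
  known : ∀ x ∈ h, x ≤ n → Known S t x

section Heap

variable {n : ℕ} {t : Tree} {S : State} {j L : ℕ} {h : List ℕ}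

theorem HeapCorrect.mono {S' : State} (hh : HeapCorrect n t S j L h) (hS : Ext S S') :
    HeapCorrect n t S' j L h :=
  ⟨hh.sorted, hh.top, hh.count, fun x hx hxn => (hh.known x hx hxn).mono hS⟩

theorem HeapCorrect.frontier (hh : HeapCorrect n t S j L h) {x : ℕ} (hxn : x ≤ n) (hx : x ∈ h) :
    Frontier t j L x := by
  by_contra hF
  have := hh.count x hxn
  rw [if_neg hF, List.count_eq_zero] at this
  exact this hx

theorem HeapCorrect.mem (hh : HeapCorrect n t S j L h) {x : ℕ} (hxn : x ≤ n)
    (hx : Frontier t j L x) : x ∈ h := by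
  have := hh.count x hxn
  rw [if_pos hx] at this
  exact List.count_pos_iff.1 (by omega)

/-- The least child beyond `L` belongs to the frontier, and everything at most `n` in the heap is a
child beyond `L`. -/
theorem HeapCorrect.next (hT : IsTree n t) (hj1 : 1 ≤ j) (hjL : j ≤ L) {r : ℕ}
    (hh : HeapCorrect n t S j L (r :: h)) : NextInGraph n t j L r := by
  have hmin : ∀ x ∈ r :: h, r ≤ x := by
    intro x hx
    rcases List.mem_cons.1 hx with rfl | hx
    · exact le_rfl
    · exact (List.pairwise_cons.1 hh.sorted).1 x hx
  refine ⟨hmin _ hh.top, fun hr => ?_, fun y hy hyP => ?_⟩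
  · have := hh.frontier hr List.mem_cons_self
    exact ⟨this.lt, this.parent⟩
  · obtain ⟨m, hm⟩ := exists_next n (fun y => L < y ∧ treeParent t y = j)
    have hmy := hm.min y hy hyP
    exact (hmin m (hh.mem (by omega) (NextInGraph.frontier hT hj1 hjL hm (by omega)))).trans hmy

theorem sorted_insert {x : ℕ} (hh : h.Pairwise (· ≤ ·)) :
    (List.orderedInsert (· ≤ ·) x h).Pairwise (· ≤ ·) :=
  hh.orderedInsert x _

theorem count_insert (x y : ℕ) (h : List ℕ) :
    (List.orderedInsert (· ≤ ·) x h).count y = h.count y + if x = y then 1 else 0 := by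
  rw [(List.perm_orderedInsert (· ≤ ·) x h).count_eq, List.count_cons]
  simp

theorem HeapCorrect.extract (hT : IsTree n t) (hj1 : 1 ≤ j) (hjL : j ≤ L) {r x₁ x₂ : ℕ}
    {S' : State} (hh : HeapCorrect n t S j L (r :: h)) (hS : Ext S S') (hrn : r ≤ n)
    (h₁ : Next n (fun y => r < y ∧ t y = t r) x₁) (hK₁ : x₁ ≤ n → Known S' t x₁)
    (h₂ : Next n (fun y => r < y ∧ t y = (r, Flag.recursive)) x₂)
    (hK₂ : x₂ ≤ n → Known S' t x₂) :
    HeapCorrect n t S' j r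
      (List.orderedInsert (· ≤ ·) x₂ (List.orderedInsert (· ≤ ·) x₁ h)) := by
  classical
  have hr := hh.next hT hj1 hjL
  refine ⟨sorted_insert (sorted_insert (List.pairwise_cons.1 hh.sorted).2), ?_, fun x hxn => ?_,
    fun x hx hxn => ?_⟩
  · rw [List.mem_orderedInsert, List.mem_orderedInsert]
    rcases List.mem_cons.1 hh.top with h | h
    · omega
    · exact Or.inr (Or.inr h)
  · obtain ⟨c1, c2, c3, c4⟩ := frontier_iff hT hj1 hjL hrn hr h₁ h₂ hxn
    have hc := hh.count x hxn
    rw [List.count_cons] at hc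
    rw [count_insert, count_insert]
    by_cases e1 : x = r
    · obtain ⟨d1, d2, d3, d4⟩ := c1 e1
      rw [if_neg d2, if_neg (Ne.symm d3), if_neg (Ne.symm d4)]
      rw [if_pos d1, e1] at hc
      rw [e1]
      simpa using hc
    · have e1' : (r == x) = false := by simpa using Ne.symm e1
      rw [e1'] at hc
      simp only [Bool.false_eq_true, if_false, add_zero] at hc
      by_cases e2 : x = x₁
      · obtain ⟨d1, d2, d3⟩ := c2 e2
        rw [hc, if_neg d1, if_pos d2, if_pos e2.symm, if_neg (Ne.symm d3)]
      · by_cases e3 : x = x₂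
        · obtain ⟨d1, d2⟩ := c3 e3
          rw [hc, if_neg d1, if_pos d2, if_pos e3.symm, if_neg (Ne.symm e2)]
        · rw [hc, if_neg (Ne.symm e2), if_neg (Ne.symm e3)]
          simp only [c4 e1 e2 e3, add_zero]
  · rw [List.mem_orderedInsert, List.mem_orderedInsert] at hx
    rcases hx with rfl | rfl | hx
    · exact hK₂ hxn
    · exact hK₁ hxn
    · exact (hh.known x (List.mem_cons_of_mem _ hx) hxn).mono hS

/-- With `n + 1` as minimum the frontier has no vertex left; any bound beyond `n` describes the same
empty frontier. -/
theorem HeapCorrect.exhausted (hT : IsTree n t) (hj1 : 1 ≤ j) (hjL : j ≤ L) {L' : ℕ}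
    (hL' : n < L') (hh : HeapCorrect n t S j L ((n + 1) :: h)) :
    HeapCorrect n t S j L' (List.orderedInsert (· ≤ ·) (n + 1) h) := by
  have hr := hh.next hT hj1 hjL
  refine ⟨sorted_insert (List.pairwise_cons.1 hh.sorted).2, ?_, fun x hxn => ?_, fun x hx hxn => ?_⟩
  · exact List.mem_orderedInsert _ |>.2 (Or.inl rfl)
  · have hL : ¬ Frontier t j L x := fun h => by
      have := hr.min x hxn ⟨h.lt, h.parent⟩
      omega
    have hc := hh.count x hxn
    rw [if_neg hL, List.count_cons] at hc
    have hL2 : ¬ Frontier t j L' x := fun h => by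
      have := h.lt
      omega
    rw [count_insert, if_neg hL2, if_neg (by omega)]
    omega
  · rw [List.mem_orderedInsert] at hx
    rcases hx with rfl | hx
    · omega
    · exact hh.known x (List.mem_cons_of_mem _ hx) hxn

/-- For `j ≠ 1` one class suffices: a recursive pointer to a vertex at most `j` leads to a graph
parent smaller than `j`. -/
theorem heapCorrect_first (hT : IsTree n t) (hj1 : 1 ≤ j) (hne : j ≠ 1) {x : ℕ}
    (hx : Next n (fun y => j < y ∧ t y = (j, Flag.direct)) x) (hK : x ≤ n → Known S t x) :
    HeapCorrect n t S j j (List.orderedInsert (· ≤ ·) x [n + 1]) := by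
  refine ⟨sorted_insert (List.pairwise_singleton _ _), ?_, fun y hyn => ?_, fun y hy hyn => ?_⟩
  · rw [List.mem_orderedInsert]
    simp
  · rw [count_insert, List.count_eq_zero.2 (by simp; omega), zero_add]
    congr 1
    refine propext ⟨?_, fun h => ?_⟩
    · rintro rfl
      obtain ⟨h1, h2⟩ := hx.prop hyn
      refine ⟨h1, ?_, by rw [h2], fun y hy hyx hty => ?_⟩
      · rw [treeParent_of_direct (by rw [h2]), h2]
      · have := hx.min y (by omega) ⟨hy, hty.trans h2⟩
        omega
    · have hjy := h.lt
      have hty : t y = (j, Flag.direct) := by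
        cases hf : (t y).2 with
        | direct =>
          have := h.parent
          rw [treeParent_of_direct hf] at this
          exact Prod.ext this hf
        | recursive =>
          exfalso
          have h1 := h.parent
          rw [treeParent_of_recursive (hT.lt y (by omega) hyn) hf] at h1
          have h2 := hT.pos y (by omega) hyn
          have h3 := h.le
          by_cases h4 : (t y).1 = 1
          · rw [h4, treeParent_one hT] at h1
            omega
          · have := treeParent_mem hT (t y).1 (by omega) (by omega)
            omega
      have h1 := hx.min y hyn ⟨hjy, hty⟩
      by_contra hne
      have h2 := hx.prop (by omega)
      exact h.first x h2.1 (by omega) (h2.2.trans hty.symm)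
  · simp only [List.mem_orderedInsert, List.mem_singleton] at hy
    rcases hy with rfl | rfl
    · exact hK hyn
    · omega

/-- The self-loop makes `1` its own parent, so recursive pointers to `1` also give children of `1`;
both flags need an entry. -/
theorem heapCorrect_root (hT : IsTree n t) {x x' : ℕ}
    (hx : Next n (fun y => 1 < y ∧ t y = (1, Flag.direct)) x) (hK : x ≤ n → Known S t x)
    (hx' : Next n (fun y => 1 < y ∧ t y = (1, Flag.recursive)) x') (hK' : x' ≤ n → Known S t x') :
    HeapCorrect n t S 1 1
      (List.orderedInsert (· ≤ ·) x' (List.orderedInsert (· ≤ ·) x [n + 1])) := by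
  classical
  have key : ∀ {f : Flag} {x : ℕ}, Next n (fun y => 1 < y ∧ t y = (1, f)) x → ∀ y ≤ n,
      (x = y ↔ Frontier t 1 1 y ∧ (t y).2 = f) := by
    intro f x hx y hyn
    constructor
    · rintro rfl
      obtain ⟨h1, h2⟩ := hx.prop hyn
      refine ⟨⟨h1, ?_, by rw [h2], fun y hy hyx hty => ?_⟩, by rw [h2]⟩
      · cases f with
        | direct => rw [treeParent_of_direct (by rw [h2]), h2]
        | recursive =>
          rw [treeParent_of_recursive (by rw [h2]; exact h1) (by rw [h2]), h2, treeParent_one hT]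
      · have := hx.min y (by omega) ⟨hy, hty.trans h2⟩
        omega
    · rintro ⟨h, hf⟩
      have h1y := h.lt
      have hty : t y = (1, f) :=
        Prod.ext (le_antisymm h.le (hT.pos y (by omega) hyn)) hf
      have h1 := hx.min y hyn ⟨h1y, hty⟩
      by_contra hne
      have h2 := hx.prop (by omega)
      exact h.first x h2.1 (by omega) (h2.2.trans hty.symm)
  refine ⟨sorted_insert (sorted_insert (List.pairwise_singleton _ _)), ?_, fun y hyn => ?_,
    fun y hy hyn => ?_⟩
  · rw [List.mem_orderedInsert, List.mem_orderedInsert]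
    simp
  · rw [count_insert, count_insert, List.count_eq_zero.2 (by simp; omega), zero_add]
    simp only [key hx y hyn, key hx' y hyn]
    by_cases hF : Frontier t 1 1 y
    · cases hf : (t y).2 <;> simp [hF]
    · simp [hF]
  · simp only [List.mem_orderedInsert, List.mem_singleton] at hy
    rcases hy with rfl | rfl | rfl
    · exact hK' hyn
    · exact hK hyn
    · omega

end Heap

/-! ### Queries -/

/-- The edges of the graph of the tree `t`. -/
def treeEdges (n : ℕ) (t : Tree) : Edges :=
  (List.range n).map fun i => (i + 1, treeParent t (i + 1))

theorem mem_treeEdges {n : ℕ} {t : Tree} {a b : ℕ} :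
    (a, b) ∈ treeEdges n t ↔ (1 ≤ a ∧ a ≤ n) ∧ treeParent t a = b := by
  simp only [treeEdges, List.mem_map, List.mem_range, Prod.mk.injEq]
  constructor
  · rintro ⟨i, hi, rfl, rfl⟩
    exact ⟨⟨by omega, by omega⟩, rfl⟩
  · rintro ⟨⟨h1, h2⟩, rfl⟩
    exact ⟨a - 1, by omega, by omega, by rw [Nat.sub_add_cancel h1]⟩

/-! ### Next neighbors in the graph of a tree -/

section NextNeighbor

variable {n : ℕ} {t : Tree} {j : ℕ}

/-- Children are larger than `j` and the parent is not, apart from the loop at `1`, where the parent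
is the least vertex anyway. -/
theorem nextNeighbor_zero (hT : IsTree n t) (hj1 : 1 ≤ j) (hjn : j ≤ n) :
    nextNeighbor n (treeEdges n t) j 0 = treeParent t j := by
  unfold nextNeighbor
  refine leastOr_eq (P := fun i => 1 ≤ i ∧ (treeParent t i = j ∨ treeParent t j = i))
    (fun y => ?_) ?_
  · simp only [Finset.mem_filter, Finset.mem_Icc, mem_treeEdges]
    constructor
    · rintro ⟨⟨h1, h2⟩, -, h3⟩
      exact ⟨h2, h1, h3.imp And.right And.right⟩
    · rintro ⟨h1, h2, h3⟩
      exact ⟨⟨h2, h1⟩, h2, h3.imp (fun h => ⟨⟨h2, h1⟩, h⟩) (fun h => ⟨⟨hj1, hjn⟩, h⟩)⟩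
  · by_cases hj : j = 1
    · subst hj
      rw [treeParent_one hT]
      exact ⟨by omega, fun _ => ⟨le_rfl, Or.inl (treeParent_one hT)⟩, fun y _ h => h.1⟩
    · have h1 := treeParent_mem hT j (by omega) hjn
      refine ⟨by omega, fun _ => ⟨h1.1, Or.inr rfl⟩, fun y hy h => ?_⟩
      rcases h with ⟨h2, h | h⟩
      · by_cases hy1 : y = 1
        · rw [hy1, treeParent_one hT] at h
          omega
        · have := treeParent_mem hT y (by omega) hy
          omega
      · omega

/-- Once the parent has been answered only children remain. They exceed `j`, which explains `max l
j`; the loop at `1` is already excluded by `l ≥ 1`. -/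
theorem nextNeighbor_of_le (hT : IsTree n t) (hj1 : 1 ≤ j) (hjn : j ≤ n) {l r : ℕ}
    (hl : treeParent t j ≤ l) (hr : NextInGraph n t j (max l j) r) :
    nextNeighbor n (treeEdges n t) j l = r := by
  unfold nextNeighbor
  refine leastOr_eq (fun y => ?_) hr
  simp only [Finset.mem_filter, Finset.mem_Icc, mem_treeEdges, sup_lt_iff]
  constructor
  · rintro ⟨⟨h1, h2⟩, h3, ⟨-, h4⟩ | ⟨-, h4⟩⟩
    · refine ⟨h2, ⟨h3, ?_⟩, h4⟩
      by_cases hy1 : y = 1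
      · subst hy1
        rw [treeParent_one hT] at h4
        subst h4
        rw [treeParent_one hT] at hl
        omega
      · have := treeParent_mem hT y (by omega) h2
        omega
    · omega
  · rintro ⟨h1, ⟨h2, h3⟩, h4⟩
    exact ⟨⟨by omega, h1⟩, h2, Or.inl ⟨⟨by omega, h1⟩, h4⟩⟩

end NextNeighbor

/-- The heap of `j` is correct if the largest earlier answer to queries on `j` is `l`. -/
structure QueryInv (n : ℕ) (t : Tree) (S : State) (l j : ℕ) : Prop where
  le : l ≤ n + 1
  fresh : S.firstQuery j = true → l = 0 ∧ S.heap j = []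
  parent_le : S.firstQuery j = false → treeParent t j ≤ l
  heap : S.firstQuery j = false → HeapCorrect n t S j (max l j) (S.heap j)

/-! ### Single queries and sequences of queries along a fixed tree -/

section Query

variable {n : ℕ} {t : Tree} {S : State}

theorem Inv.congr {S' : State} {e : ℕ} (h : Inv n S e) (hp : S'.ptr = S.ptr)
    (hf : S'.front = S.front) : Inv n S' e := by
  obtain ⟨p, f, hh, q⟩ := S
  obtain ⟨p', f', hh', q'⟩ := S'
  simp only at hp hf
  subst hp hf
  exact ⟨h.pos, h.lt, h.u_front, h.ptr_ne, h.chain⟩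

theorem Ext.congr {S' : State} (hp : S'.ptr = S.ptr) (hf : S'.front = S.front) : Ext S S' :=
  ⟨fun y p h => by rw [hp, h], fun j f h => ⟨f, by rw [hf, h], le_rfl⟩⟩

theorem sim_heapInsert (S : State) (j x : ℕ) :
    Sim n t (heapInsert j x) S PUnit.unit
      (S.setHeap j (List.orderedInsert (· ≤ ·) x (S.heap j))) :=
  Sim.modify _ S rfl rfl

/-- The last conclusion takes an arbitrary continuation, so that several insertions can be chained
inside one program. -/
theorem exists_sim_insert_nextChildTp (hT : IsTree n t) {i : ℕ} (τ : Flag) (hi1 : 1 ≤ i)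
    (hin : i ≤ n) {k : ℕ} (hW : weight n S t ≠ 0) (hI : Inv n S 0) (hik : i ≤ k)
    (hk : k = i ∨ ∃ f, S.front i = some f ∧ k ≤ f) (j : ℕ) :
    ∃ x S', Next n (fun y => k < y ∧ t y = (i, τ)) x ∧ (x ≤ n → Known S' t x) ∧
      weight n S' t ≠ 0 ∧ Inv n S' 0 ∧ Ext S S' ∧
      S'.heap = Function.update S.heap j (List.orderedInsert (· ≤ ·) x (S.heap j)) ∧
      S'.firstQuery = S.firstQuery ∧
      ∀ {β : Type} (f : ℕ → PUnit → Gen β) (b : β) (S'' : State),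
        Sim n t (f x PUnit.unit) S' b S'' →
        Sim n t (nextChildTp n i k τ >>= fun x => heapInsert j x >>= f x) S b S'' := by
  obtain ⟨x, S₁, hstep, hx, hK⟩ := exists_step_nextChildTp hT τ hi1 hin k S hW hI hik hk
  have hW₁ := hstep.sim.weight_ne_zero hW
  have hins := sim_heapInsert (n := n) (t := t) S₁ j x
  refine ⟨x, S₁.setHeap j (List.orderedInsert (· ≤ ·) x (S₁.heap j)), hx, hK,
    hins.weight_ne_zero hW₁, hstep.inv.congr rfl rfl, hstep.frame.toExt.trans (Ext.congr rfl rfl),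
    ?_, hstep.frame.firstQuery, fun f b S'' hf => hstep.sim.bind (hins.bind hf)⟩
  simp only [State.setHeap, hstep.frame.heap]

theorem QueryInv.mono {S' : State} {l v : ℕ} (h : QueryInv n t S l v) (hE : Ext S S')
    (hheap : S'.heap v = S.heap v) (hq : S'.firstQuery v = S.firstQuery v) :
    QueryInv n t S' l v := by
  refine ⟨h.le, fun h' => ?_, fun h' => ?_, fun h' => ?_⟩
  · rw [hheap]
    exact h.fresh (hq ▸ h')
  · exact h.parent_le (hq ▸ h')
  · rw [hheap]
    exact (h.heap (hq ▸ h')).mono hE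

/-- How a query on `j` changes the memory. -/
structure QueryStep (n : ℕ) (t : Tree) (j r L : ℕ) (S S' : State) : Prop where
  sim : Sim n t (baNextNeighbor n j) S r S'
  inv : Inv n S' 0
  ext : Ext S S'
  heap : ∀ v, v ≠ j → S'.heap v = S.heap v
  firstQuery : S'.firstQuery = Function.update S.firstQuery j false
  correct : HeapCorrect n t S' j L (S'.heap j)

theorem exists_queryStep_first (hT : IsTree n t) (hW : weight n S t ≠ 0) (hI : Inv n S 0) {j : ℕ}
    (hj1 : 1 ≤ j) (hjn : j ≤ n) (hfq : S.firstQuery j = true) (hheap : S.heap j = []) :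
    ∃ S', QueryStep n t j (treeParent t j) j S S' := by
  have hs₀ : Sim n t (modify fun S => S.unsetFirstQuery j : Gen PUnit) S PUnit.unit
    (S.unsetFirstQuery j) := Sim.modify _ S rfl rfl
  have hs₁ := sim_heapInsert (n := n) (t := t) (S.unsetFirstQuery j) j (n + 1)
  set S₁ := (S.unsetFirstQuery j).setHeap j
    (List.orderedInsert (· ≤ ·) (n + 1) ((S.unsetFirstQuery j).heap j)) with hS₁
  have hW₁ := hs₁.weight_ne_zero (hs₀.weight_ne_zero hW)
  have hI₁ : Inv n S₁ 0 := hI.congr rfl rfl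
  have hE₁ : Ext S S₁ := Ext.congr rfl rfl
  have hh₁ : S₁.heap = Function.update S.heap j [n + 1] := by
    simp [hS₁, State.setHeap, State.unsetFirstQuery, hheap]
  have hq₁ : S₁.firstQuery = Function.update S.firstQuery j false := rfl
  obtain ⟨x, S₂, hx, hK, hW₂, hI₂, hE₂, hh₂, hq₂, hs₂⟩ :=
    exists_sim_insert_nextChildTp hT Flag.direct hj1 hjn hW₁ hI₁ le_rfl (Or.inl rfl) j
  rw [hh₁, Function.update_idem, Function.update_self] at hh₂
  by_cases hj : j = 1
  · subst hj
    obtain ⟨y, S₃, hy, hK', hW₃, hI₃, hE₃, hh₃, hq₃, hs₃⟩ :=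
      exists_sim_insert_nextChildTp hT Flag.recursive hj1 hjn hW₂ hI₂ le_rfl (Or.inl rfl) 1
    rw [hh₂, Function.update_idem, Function.update_self] at hh₃
    obtain ⟨S₄, hstep⟩ := exists_step_baParent hT 1 S₃ hW₃ hI₃ hj1 hjn
    have hh₄ := hstep.frame.heap.trans hh₃
    refine ⟨S₄, ?_, hstep.inv, hE₁.trans (hE₂.trans (hE₃.trans hstep.frame.toExt)), ?_, ?_, ?_⟩
    · unfold baNextNeighbor
      refine Sim.get_bind ?_
      rw [if_pos hfq]
      refine hs₀.bind (hs₁.bind (hs₂ (fun _ _ => _) _ _ ?_))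
      rw [if_pos rfl]
      exact hs₃ (fun _ _ => _) _ _ hstep.sim
    · intro v hv
      rw [hh₄, Function.update_of_ne hv]
    · rw [hstep.frame.firstQuery, hq₃, hq₂, hq₁]
    · rw [hh₄, Function.update_self]
      exact (heapCorrect_root hT hx (fun h => (hK h).mono hE₃) hy hK').mono hstep.frame.toExt
  · obtain ⟨S₄, hstep⟩ := exists_step_baParent hT j S₂ hW₂ hI₂ hj1 hjn
    have hh₄ := hstep.frame.heap.trans hh₂
    refine ⟨S₄, ?_, hstep.inv, hE₁.trans (hE₂.trans hstep.frame.toExt), ?_, ?_, ?_⟩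
    · unfold baNextNeighbor
      refine Sim.get_bind ?_
      rw [if_pos hfq]
      refine hs₀.bind (hs₁.bind (hs₂ (fun _ _ => _) _ _ ?_))
      rw [if_neg hj]
      exact hstep.sim
    · intro v hv
      rw [hh₄, Function.update_of_ne hv]
    · rw [hstep.frame.firstQuery, hq₂, hq₁]
    · rw [hh₄, Function.update_self]
      exact (heapCorrect_first hT hj1 hj hx hK).mono hstep.frame.toExt

theorem exists_queryStep_later (hT : IsTree n t) (hW : weight n S t ≠ 0) (hI : Inv n S 0) {j L : ℕ}
    (hj1 : 1 ≤ j) (hjL : j ≤ L) (hfq : S.firstQuery j = false)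
    (hheap : HeapCorrect n t S j L (S.heap j)) :
    ∃ r S', QueryStep n t j r (max r j) S S' ∧ NextInGraph n t j L r := by
  obtain ⟨r, h, hrh⟩ : ∃ r h, S.heap j = r :: h := by
    cases hh : S.heap j with
    | nil =>
      have := hheap.top
      rw [hh] at this
      simp at this
    | cons r h => exact ⟨r, h, rfl⟩
  rw [hrh] at hheap
  have hr := hheap.next hT hj1 hjL
  have hfq' : S.firstQuery = Function.update S.firstQuery j false := by
    rw [← hfq, Function.update_eq_self]
  have hs₀ : Sim n t (modify fun S => S.setHeap j h : Gen PUnit) S PUnit.unit (S.setHeap j h) :=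
    Sim.modify _ S rfl rfl
  by_cases hrn1 : r = n + 1
  · have hs₁ := sim_heapInsert (n := n) (t := t) (S.setHeap j h) j (n + 1)
    refine ⟨r, (S.setHeap j h).setHeap j (List.orderedInsert (· ≤ ·) (n + 1) ((S.setHeap j h).heap j)),
      ⟨?_, hI.congr rfl rfl, Ext.congr rfl rfl, ?_, hfq', ?_⟩, hr⟩
    · unfold baNextNeighbor
      refine Sim.get_bind ?_
      rw [if_neg (by simp [hfq])]
      simp only [hrh]
      refine hs₀.bind ?_
      rw [if_pos hrn1, hrn1]
      exact hs₁.bind (Sim.pure _ _)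
    · intro v hv
      simp [State.setHeap, hv]
    · subst hrn1
      have := hheap.exhausted hT hj1 hjL (L' := max (n + 1) j) (by omega)
      simp only [State.setHeap, Function.update_self]
      exact this.mono (Ext.congr rfl rfl)
  · have hrn : r ≤ n := by
      have := hr.le
      omega
    obtain ⟨hLr, hrj⟩ := hr.prop hrn
    have hKr : Known S t r := hheap.known r List.mem_cons_self hrn
    have hpr := hKr.ptr hT hW (by omega) hrn
    obtain ⟨f, hf, hrf⟩ := hKr
    have hpos := hT.pos r (by omega) hrn
    have hlt := hT.lt r (by omega) hrn
    have hW₀ := hs₀.weight_ne_zero hW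
    have hI₀ : Inv n (S.setHeap j h) 0 := hI.congr rfl rfl
    have hh₀ : (S.setHeap j h).heap = Function.update S.heap j h := rfl
    have hq₀ : (S.setHeap j h).firstQuery = S.firstQuery := rfl
    -- inserting two vertices into the heap
    have key : ∀ S₁, weight n S₁ t ≠ 0 → Inv n S₁ 0 → Ext S S₁ →
        S₁.heap = Function.update S.heap j h → S₁.firstQuery = S.firstQuery →
        ∃ S', Inv n S' 0 ∧ Ext S S' ∧ (∀ v, v ≠ j → S'.heap v = S.heap v) ∧
          S'.firstQuery = S.firstQuery ∧ HeapCorrect n t S' j (max r j) (S'.heap j) ∧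
          Sim n t (do
            let x ← nextChildTp n (t r).1 r (t r).2
            heapInsert j x
            let y ← nextChildTp n r r Flag.recursive
            heapInsert j y
            return r) S₁ r S' := by
      intro S₁ hW₁ hI₁ hE₁ hh₁ hq₁
      obtain ⟨f', hf', hff'⟩ := hE₁.front _ f hf
      obtain ⟨x, S₂, hx, hK, hW₂, hI₂, hE₂, hh₂, hq₂, hs₂⟩ :=
        exists_sim_insert_nextChildTp hT (t r).2 hpos (by omega) hW₁ hI₁ hlt.le
          (Or.inr ⟨f', hf', hrf.trans hff'⟩) j
      rw [hh₁, Function.update_idem, Function.update_self] at hh₂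
      obtain ⟨y, S₃, hy, hK', hW₃, hI₃, hE₃, hh₃, hq₃, hs₃⟩ :=
        exists_sim_insert_nextChildTp hT Flag.recursive (by omega) hrn hW₂ hI₂ le_rfl (Or.inl rfl) j
      rw [hh₂, Function.update_idem, Function.update_self] at hh₃
      refine ⟨S₃, hI₃, hE₁.trans (hE₂.trans hE₃), fun v hv => ?_, hq₃.trans (hq₂.trans hq₁), ?_,
        hs₂ (fun _ _ => _) _ _ (hs₃ (fun _ _ => _) _ _ (Sim.pure _ _))⟩
      · rw [hh₃, Function.update_of_ne hv]
      · rw [hh₃, Function.update_self, max_eq_left (by omega)]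
        exact hheap.extract hT hj1 hjL (hE₁.trans (hE₂.trans hE₃)) hrn hx
          (fun h => (hK h).mono hE₃) hy hK'
    by_cases hdir : (t r).2 = Flag.direct
    · have htj : (t r).1 = j := by rw [← treeParent_of_direct hdir, hrj]
      obtain ⟨S', h1, h2, h3, h4, h5, h6⟩ := key _ hW₀ hI₀ (Ext.congr rfl rfl) hh₀ hq₀
      refine ⟨r, S', ⟨?_, h1, h2, h3, h4.trans hfq', h5⟩, hr⟩
      unfold baNextNeighbor
      refine Sim.get_bind ?_
      rw [if_neg (by simp [hfq])]
      simp only [hrh]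
      refine hs₀.bind ?_
      rw [if_neg hrn1, if_pos (by simp [State.flag, hpr, hdir])]
      rw [hdir, htj] at h6
      exact h6
    · have hrec : (t r).2 = Flag.recursive := by
        cases hf : (t r).2 with
        | direct => exact absurd hf hdir
        | recursive => rfl
      obtain ⟨S₁, hs₁, hI₁, hF₁, -, -⟩ := exists_sim_parent hW₀ hI₀ (j := r) (by omega) hrn
      obtain ⟨S', h1, h2, h3, h4, h5, h6⟩ := key S₁ (hs₁.weight_ne_zero hW₀) hI₁
        ((Ext.congr rfl rfl : Ext S (S.setHeap j h)).trans hF₁.toExt) (hF₁.heap.trans hh₀)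
        (hF₁.firstQuery.trans hq₀)
      refine ⟨r, S', ⟨?_, h1, h2, h3, h4.trans hfq', h5⟩, hr⟩
      unfold baNextNeighbor
      refine Sim.get_bind ?_
      rw [if_neg (by simp [hfq])]
      simp only [hrh]
      refine hs₀.bind ?_
      rw [if_neg hrn1, if_neg (by simp [State.flag, hpr, hdir])]
      rw [hrec] at h6
      exact hs₁.bind h6

theorem exists_sim_queries (hT : IsTree n t) (Q : List ℕ) (hQ : ∀ v ∈ Q, 1 ≤ v ∧ v ≤ n)
    (S : State) (last : ℕ → ℕ) (hW : weight n S t ≠ 0) (hI : Inv n S 0)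
    (hq : ∀ v, 1 ≤ v → v ≤ n → QueryInv n t S (last v) v) :
    ∃ S', Sim n t (Q.mapM (baNextNeighbor n)) S (answers n (treeEdges n t) last Q) S' := by
  induction Q generalizing S last with
  | nil => exact ⟨S, Sim.pure _ _⟩
  | cons j Q ih =>
    obtain ⟨hj1, hjn⟩ := hQ j List.mem_cons_self
    have hqj := hq j hj1 hjn
    obtain ⟨S', hstep, hle, hle'⟩ : ∃ S', QueryStep n t j (nextNeighbor n (treeEdges n t) j (last j))
        (max (max (last j) (nextNeighbor n (treeEdges n t) j (last j))) j) S S' ∧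
        treeParent t j ≤ max (last j) (nextNeighbor n (treeEdges n t) j (last j)) ∧
        max (last j) (nextNeighbor n (treeEdges n t) j (last j)) ≤ n + 1 := by
      cases hfq : S.firstQuery j with
      | true =>
        obtain ⟨hl, hh⟩ := hqj.fresh hfq
        obtain ⟨S', h⟩ := exists_queryStep_first hT hW hI hj1 hjn hfq hh
        rw [hl, nextNeighbor_zero hT hj1 hjn]
        have hpj : treeParent t j ≤ j := by
          by_cases hj : j = 1
          · rw [hj, treeParent_one hT]
          · exact (treeParent_mem hT j (by omega) hjn).2.le
        refine ⟨S', ?_, by omega, by omega⟩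
        rwa [show max (max 0 (treeParent t j)) j = j by omega]
      | false =>
        have hle := hqj.parent_le hfq
        obtain ⟨r, S', h, hr⟩ := exists_queryStep_later hT hW hI hj1 (le_max_right _ _) hfq
          (hqj.heap hfq)
        rw [nextNeighbor_of_le hT hj1 hjn hle hr]
        have hlr : last j ≤ r := by
          by_cases hrn : r ≤ n
          · have := (hr.prop hrn).1
            omega
          · have := hqj.le
            omega
        have := hr.le
        refine ⟨S', ?_, by omega, by omega⟩
        rwa [max_eq_right hlr]
    set r := nextNeighbor n (treeEdges n t) j (last j)
    obtain ⟨S'', h⟩ := ih (fun v hv => hQ v (List.mem_cons_of_mem _ hv)) S'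
      (Function.update last j (max (last j) r)) (hstep.sim.weight_ne_zero hW) hstep.inv
      (fun v hv1 hvn => by
        by_cases hvj : v = j
        · subst hvj
          rw [Function.update_self]
          have hf : S'.firstQuery v = false := by rw [hstep.firstQuery, Function.update_self]
          exact ⟨hle', fun h => by simp [hf] at h, fun _ => hle, fun _ => hstep.correct⟩
        · rw [Function.update_of_ne hvj]
          exact (hq v hv1 hvn).mono hstep.ext (hstep.heap v hvj)
            (by rw [hstep.firstQuery, Function.update_of_ne hvj]))
    refine ⟨S'', ?_⟩
    rw [List.mapM_cons]
    exact hstep.sim.bind (h.bind (Sim.pure _ _))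

end Query

/-! ### The distribution of the graph -/

theorem Phi_init (j : ℕ) : State.init.Phi j = Finset.Ico 1 j := by
  simp [State.Phi, State.init]

theorem isTree_of_weight {n : ℕ} {t : Tree} (hn : 1 ≤ n) (hW : weight n State.init t ≠ 0) :
    IsTree n t := by
  have hmem : ∀ j, 2 ≤ j → j ≤ n → (t j).1 ∈ Finset.Ico 1 j := by
    intro j hj hjn
    have h := draw_ne_zero hW (by omega) hjn
    rw [draw_of_nonempty rfl (by rw [Phi_init]; exact ⟨1, by simp; omega⟩), Phi_init] at h
    by_contra h'
    simp only [if_neg h', ne_eq, not_true_eq_false] at h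
  refine ⟨?_, fun j hj hjn => (Finset.mem_Ico.1 (hmem j hj hjn)).1,
    fun j hj hjn => (Finset.mem_Ico.1 (hmem j hj hjn)).2⟩
  have h := draw_ne_zero hW le_rfl hn
  rw [draw_of_empty rfl (by simp [Phi_init])] at h
  by_contra h'
  simp [h'] at h

theorem weight_of_treeDist {n : ℕ} {t : Tree} {S : State} (h : treeDist S n t ≠ 0) :
    weight n S t ≠ 0 := by
  classical
  rw [treeDist_apply] at h
  split_ifs at h
  · exact h
  · exact absurd rfl h

theorem bind_congr_of_ne_zero {α β : Type} {p : PMF α} {f g : α → PMF β}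
    (h : ∀ a, p a ≠ 0 → f a = g a) : p.bind f = p.bind g := by
  ext b
  rw [PMF.bind_apply, PMF.bind_apply]
  refine tsum_congr fun a => ?_
  by_cases ha : p a = 0
  · simp [ha]
  · rw [h a ha]

theorem map_congr_of_ne_zero {α β : Type} {p : PMF α} {f g : α → β}
    (h : ∀ a, p a ≠ 0 → f a = g a) : p.map f = p.map g := by
  rw [← PMF.bind_pure_comp, ← PMF.bind_pure_comp]
  exact bind_congr_of_ne_zero fun a ha => by simp [h a ha]

theorem treeParent_update {t : Tree} {m j : ℕ} {p : ℕ × Flag} (hj : j < m) :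
    treeParent (Function.update t m p) j = treeParent t j := by
  induction j using Nat.strong_induction_on with
  | _ j ih =>
  have hu : Function.update t m p j = t j := Function.update_of_ne (by omega) _ _
  rw [treeParent, treeParent.eq_1 t j, hu]
  by_cases h : (t j).1 < j ∧ (t j).2 = Flag.recursive
  · rw [dif_pos h, dif_pos h, ih _ h.1 (by omega)]
  · rw [dif_neg h, dif_neg h]

/-- The head of an edge whose pointer is `p.1` with flag `p.2`. -/
def headOf (t : Tree) (p : ℕ × Flag) : ℕ :=
  match p.2 with
  | Flag.direct => p.1
  | Flag.recursive => treeParent t p.1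

theorem treeParent_update_self {t : Tree} {m : ℕ} {p : ℕ × Flag} (hp : p.1 < m) :
    treeParent (Function.update t m p) m = headOf t p := by
  obtain ⟨i, f⟩ := p
  cases f with
  | direct => rw [treeParent_of_direct (by simp)]; simp [headOf]
  | recursive =>
    rw [treeParent_of_recursive (by simpa using hp) (by simp), Function.update_self,
      treeParent_update hp]
    rfl

theorem treeEdges_succ_update {t : Tree} {m : ℕ} {p : ℕ × Flag} (hp : p.1 < m + 1) :
    treeEdges (m + 1) (Function.update t (m + 1) p) = treeEdges m t ++ [(m + 1, headOf t p)] := by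
  unfold treeEdges
  rw [List.range_succ, List.map_append]
  congr 1
  · refine List.map_congr_left fun i hi => ?_
    rw [List.mem_range] at hi
    rw [treeParent_update (by omega)]
  · simp [treeParent_update_self hp]

theorem count_map_range (f : ℕ → ℕ) (v m : ℕ) :
    ((List.range m).map f).count v = ∑ i ∈ Finset.range m, if f i = v then 1 else 0 := by
  induction m with
  | zero => simp
  | succ m ih =>
    rw [List.range_succ, List.map_append, List.count_append, ih, Finset.sum_range_succ]
    simp [List.count_cons]

/-- A uniform `i` chooses an edge and the fair flag one of its two ends, `i` or the parent of `i`.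
Each vertex is thus hit in proportion to its degree. -/
theorem draw_init_map_headOf (t : Tree) (m : ℕ) :
    (draw State.init (m + 2)).map (headOf t) = degreeDist (treeEdges (m + 1) t) := by
  have hne : (Finset.Ico 1 (m + 2)).Nonempty := ⟨1, by simp⟩
  have hd : draw State.init (m + 2) = (PMF.uniformOfFinset (Finset.Ico 1 (m + 2)) hne).bind fun i =>
      (PMF.uniformOfFintype Flag).map fun f => (i, f) := by
    have h : (State.init.Phi (m + 2)).Nonempty := by rwa [Phi_init]
    have h0 : State.init.ptr (m + 2) = none := rfl
    simp only [draw, h0, dif_pos h]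
    congr 1
    simp only [Phi_init]
  ext v
  rw [degreeDist_apply _ (by simp [treeEdges]), hd, PMF.map_bind, PMF.bind_apply,
    tsum_eq_sum (s := Finset.Ico 1 (m + 2)) (fun i hi => by
      rw [PMF.uniformOfFinset_apply_of_notMem hne hi, zero_mul])]
  have hflag : ∀ i, (PMF.map (headOf t) ((PMF.uniformOfFintype Flag).map fun f => (i, f))) v =
      2⁻¹ * ((if i = v then 1 else 0) + if treeParent t i = v then 1 else 0) := by
    intro i
    rw [PMF.map_comp, PMF.map_apply, tsum_fintype]
    have : (Finset.univ : Finset Flag) = {Flag.direct, Flag.recursive} := rfl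
    rw [this, Finset.sum_pair (by decide)]
    simp only [Function.comp, headOf, uniformFlag_apply, mul_add, mul_ite, mul_one, mul_zero,
      eq_comm (a := v)]
  have hdeg : (deg v (treeEdges (m + 1) t) : ENNReal) =
      ∑ i ∈ Finset.Ico 1 (m + 2), ((if i = v then 1 else 0) + if treeParent t i = v then 1 else 0) := by
    have e1 : (treeEdges (m + 1) t).map Prod.fst = (List.range (m + 1)).map fun i => i + 1 := by
      simp [treeEdges]
    have e2 : (treeEdges (m + 1) t).map Prod.snd =
        (List.range (m + 1)).map fun i => treeParent t (i + 1) := by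
      simp [treeEdges]
    unfold deg
    rw [e1, e2, count_map_range, count_map_range, Finset.sum_add_distrib,
      Finset.sum_Ico_eq_sum_range, Finset.sum_Ico_eq_sum_range]
    push_cast
    simp only [add_comm 1]
  have hcard : (Finset.Ico 1 (m + 2)).card = m + 1 := by simp
  have hlen : (treeEdges (m + 1) t).length = m + 1 := by simp [treeEdges]
  rw [hdeg, hlen, div_eq_mul_inv, Finset.sum_mul]
  refine Finset.sum_congr rfl fun i hi => ?_
  rw [PMF.uniformOfFinset_apply_of_mem hne hi, hflag, hcard, Nat.cast_mul,
    ENNReal.mul_inv (by simp) (by simp), Nat.cast_ofNat]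
  ring

theorem fst_lt_of_draw_init {m : ℕ} {p : ℕ × Flag} (h : draw State.init (m + 2) p ≠ 0) :
    p.1 < m + 2 := by
  rw [draw_of_nonempty rfl (by rw [Phi_init]; exact ⟨1, by simp⟩), Phi_init] at h
  by_contra h'
  rw [if_neg (by simp; omega)] at h
  exact h rfl

theorem BA_eq_map_treeDist (n : ℕ) : BA n = (treeDist State.init n).map (treeEdges n) := by
  induction n with
  | zero => simp [BA, treeDist, treeEdges, PMF.pure_map]
  | succ n ih =>
    cases n with
    | zero =>
      rw [treeDist, treeDist, PMF.pure_bind, PMF.map_comp,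
        draw_of_empty rfl (by simp [Phi_init]), PMF.pure_map, BA]
      congr 1
      simp [treeEdges, treeParent_of_direct]
    | succ m =>
      rw [BA, ih, treeDist.eq_2 State.init (m + 1), PMF.map_bind, PMF.bind_map]
      refine bind_congr_of_ne_zero fun t ht => ?_
      rw [Function.comp, ← draw_init_map_headOf, PMF.map_comp, PMF.map_comp]
      refine map_congr_of_ne_zero fun p hp => ?_
      exact (treeEdges_succ_update (fst_lt_of_draw_init hp)).symm

/-! ### Equality of the distributions -/

/-- A strict inequality at one point would make the total masses, both equal to 1, different. -/
theorem eq_of_apply_le {α : Type} {p q : PMF α} (h : ∀ a, p a ≤ q a) : p = q := by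
  ext a
  refine le_antisymm (h a) (not_lt.1 fun hlt => ?_)
  have := ENNReal.tsum_lt_tsum (f := p) (g := q) (by rw [p.tsum_coe]; simp) h hlt
  rw [p.tsum_coe, q.tsum_coe] at this
  exact lt_irrefl _ this

open Classical in
/-- If along every tree the program computes `g`, then its result has the distribution of `g`. -/
theorem map_treeDist_eq_run' {n : ℕ} {α : Type} {op : Gen α} {S : State} {g : Tree → α}
    (h : ∀ t, weight n S t ≠ 0 → ∃ S', Sim n t op S (g t) S') :
    (treeDist S n).map g = StateT.run' op S := by
  refine eq_of_apply_le fun a => ?_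
  have hrun : StateT.run' op S a = ∑' S', op.run S (a, S') := by
    change (PMF.map Prod.fst (op.run S)) a = _
    rw [PMF.map_apply, ENNReal.tsum_prod', tsum_eq_single a]
    · simp
    · intro b hb
      simp [Ne.symm hb]
  rw [hrun, PMF.map_apply]
  calc ∑' t, (if a = g t then treeDist S n t else 0)
      ≤ ∑' t, ∑' S', op.run S (a, S') * treeDist S' n t := by
        refine ENNReal.tsum_le_tsum fun t => ?_
        split_ifs with hat
        · by_cases h0 : treeDist S n t = 0
          · simp [h0]
          · obtain ⟨S', hS'⟩ := h t (weight_of_treeDist h0)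
            -- Of all final memories only the one provided for `t` is kept.
            refine le_trans ?_ (ENNReal.le_tsum S')
            rw [treeDist_apply] at h0
            rw [treeDist_apply, treeDist_apply]
            split_ifs at h0 ⊢
            · rw [hat]
              exact hS'
            · exact absurd rfl h0
        · exact zero_le
    _ = ∑' S', op.run S (a, S') * ∑' t, treeDist S' n t := by
        rw [ENNReal.tsum_comm]
        simp only [ENNReal.tsum_mul_left]
    _ = ∑' S', op.run S (a, S') := by
        simp only [PMF.tsum_coe, mul_one]

theorem optBA_eq_otFBA {n : ℕ} (hn : 1 ≤ n) (Q : List ℕ) (hQ : ∀ v ∈ Q, 1 ≤ v ∧ v ≤ n) :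
    OptBA n Q = OtFBA n Q := by
  rw [OptBA, OtFBA, BA_eq_map_treeDist, PMF.map_comp]
  refine map_treeDist_eq_run' fun t hW => ?_
  refine exists_sim_queries (isTree_of_weight hn hW) Q hQ State.init (fun _ => 0) hW
    ⟨?_, ?_, ?_, ?_, ?_⟩ fun v _ _ => ⟨by simp, fun _ => ⟨rfl, rfl⟩, ?_, ?_⟩ <;>
  simp [State.init]

end BAGen

theorem mainTheorem1 (n : ℕ) (Q : List ℕ) (hQ : ∀ v ∈ Q, 1 ≤ v ∧ v ≤ n) :
    BAGen.OptBA n Q = BAGen.OtFBA n Q := by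
  -- The root condition of `IsTree` needs `1 ≤ n`, which any query forces; without queries both
  -- answers are the empty list.
  rcases Q with _ | ⟨v, Q⟩
  · change PMF.map (fun _ => []) (BAGen.BA n) = PMF.map Prod.fst (PMF.pure ([], BAGen.State.init))
    rw [PMF.pure_map]
    exact PMF.map_const _ _
  · have := hQ v List.mem_cons_self
    exact BAGen.optBA_eq_otFBA (by omega) _ hQ
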